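/- Let $p$ be a prime with $p-1=2^{n-1}t$, where $n\ge 3$ and $t$ is odd (so $p\equiv 1 \bmod 4$). Let $r$ be a primitive root modulo $p$, and let $k,q$ be integers with $r^{t}\equiv -kq \pmod p$. Let $$P=\langle x,y,z \mid x^p=y^p=z^p=1,\ xy=yx,\ yz=zyx,\ xz=zx\rangle$$ be the extraspecial group of order $p^3$ and exponent $p$, let $\theta$ be the automorphism of $P$ with $x\mapsto x^{r^t}$, $y\mapsto z^k$, $z\mapsto y^q$ (which satisfies $\theta^{2^n}=1$), and let $G=G_{p^32^n}=P\rtimes\langle w\rangle$ be the semidirect product of $P$ with the cyclic group $\langle w\rangle$ of order $2^n$, where $w^{-1}gw=\theta(g)$ for $g\in P$. Let $Q=\langle x,y,w^{2^{n-1}}\rangle\le G$. A linear character is a complex character of degree $1$, and $\phi^G$ denotes the character of $G$ induced from a character $\phi$ of a subgroup. Then: (i) $G$ has exactly $2^n$ linear characters, all of them trivial on $P$. If $\zeta\in\mathbb C$ is a primitive $2^n$-th root of unity, they are the $\lambda_i$, $0\le i\le 2^n-1$, with $\lambda_i(x)=\lambda_i(y)=\lambda_i(z)=1$ and $\lambda_i(w)=\zeta^i$,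 and these are pairwise distinct. (ii) The nonlinear irreducible complex characters of $G$ are exactly the characters (a) $\phi^G$, where $\phi$ is a non-principal linear character of $P$, and (b) $\psi^G$, where $\psi$ is a linear character of $Q$ with $x\notin\ker\psi$. The families (a) and (b) are disjoint. Family (a) consists of exactly $(p^2-1)/2^n$ distinct characters, all of degree $2^n$; family (b) consists of exactly $(p-1)/2^{n-2}$ distinct characters, all of degree $p\cdot 2^{n-1}$. -/

import Mathlib

namespace GpTwo

/-- The three generators of the extraspecial group of order `p ^ 3` and exponent `p`. -/
inductive Gen : Type
  | x : Gen
  | y : Gen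
  | z : Gen

/-- The relations `x ^ p = y ^ p = z ^ p = 1`, `x y = y x`, `y z = z y x`, `x z = z x`. -/
def rels (p : ℕ) : Set (FreeGroup Gen) :=
  { FreeGroup.of Gen.x ^ p,
    FreeGroup.of Gen.y ^ p,
    FreeGroup.of Gen.z ^ p,
    (FreeGroup.of Gen.x * FreeGroup.of Gen.y) * (FreeGroup.of Gen.y * FreeGroup.of Gen.x)⁻¹,
    (FreeGroup.of Gen.y * FreeGroup.of Gen.z) *
      (FreeGroup.of Gen.z * FreeGroup.of Gen.y * FreeGroup.of Gen.x)⁻¹,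
    (FreeGroup.of Gen.x * FreeGroup.of Gen.z) * (FreeGroup.of Gen.z * FreeGroup.of Gen.x)⁻¹ }

/-- The extraspecial group of order `p ^ 3` and exponent `p`, given by its presentation. -/
abbrev ExtraSpecial (p : ℕ) : Type := PresentedGroup (rels p)

namespace ExtraSpecial

/-- The generator `x` of the extraspecial group. -/
def x (p : ℕ) : ExtraSpecial p := PresentedGroup.of Gen.x

/-- The generator `y` of the extraspecial group. -/
def y (p : ℕ) : ExtraSpecial p := PresentedGroup.of Gen.y

/-- The generator `z` of the extraspecial group. -/
def z (p : ℕ) : ExtraSpecial p := PresentedGroup.of Gen.z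

variable {p : ℕ}

theorem x_pow : x p ^ p = 1 :=
  PresentedGroup.one_of_mem (rels := rels p) (x := FreeGroup.of Gen.x ^ p) (by simp [rels])

theorem y_pow : y p ^ p = 1 :=
  PresentedGroup.one_of_mem (rels := rels p) (x := FreeGroup.of Gen.y ^ p) (by simp [rels])

theorem z_pow : z p ^ p = 1 :=
  PresentedGroup.one_of_mem (rels := rels p) (x := FreeGroup.of Gen.z ^ p) (by simp [rels])

theorem x_mul_y : x p * y p = y p * x p :=
  PresentedGroup.mk_eq_mk_of_mul_inv_mem (rels := rels p)
    (x := FreeGroup.of Gen.x * FreeGroup.of Gen.y)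
    (y := FreeGroup.of Gen.y * FreeGroup.of Gen.x) (by simp [rels])

theorem y_mul_z : y p * z p = z p * y p * x p :=
  PresentedGroup.mk_eq_mk_of_mul_inv_mem (rels := rels p)
    (x := FreeGroup.of Gen.y * FreeGroup.of Gen.z)
    (y := FreeGroup.of Gen.z * FreeGroup.of Gen.y * FreeGroup.of Gen.x) (by simp [rels])

theorem x_mul_z : x p * z p = z p * x p :=
  PresentedGroup.mk_eq_mk_of_mul_inv_mem (rels := rels p)
    (x := FreeGroup.of Gen.x * FreeGroup.of Gen.z)
    (y := FreeGroup.of Gen.z * FreeGroup.of Gen.x) (by simp [rels])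

theorem zpow_congr {G : Type*} [Group G] {g : G} (hg : g ^ p = 1) {a b : ℤ}
    (h : (a : ZMod p) = b) : g ^ a = g ^ b := by
  have h1 : (p : ℤ) ∣ b - a := (ZMod.intCast_eq_intCast_iff_dvd_sub a b p).1 h
  obtain ⟨c, hc⟩ := h1
  have : b = a + p * c := by linarith
  rw [this, zpow_add, zpow_mul, zpow_natCast, hg, one_zpow, mul_one]

theorem y_zpow_mul_z (a : ℤ) : y p ^ a * z p = z p * y p ^ a * x p ^ a := by
  have h1 : (z p)⁻¹ * y p * z p = y p * x p := by
    rw [mul_assoc, y_mul_z]; group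
  have hc : Commute (y p) (x p) := x_mul_y.symm
  have h2 : (z p)⁻¹ * y p ^ a * z p = y p ^ a * x p ^ a := by
    rw [← hc.mul_zpow, ← h1]
    have := conj_zpow (i := a) (a := (z p)⁻¹) (b := y p)
    simpa using this.symm
  calc y p ^ a * z p = z p * ((z p)⁻¹ * y p ^ a * z p) := by group
    _ = _ := by rw [h2, mul_assoc]

theorem y_zpow_mul_z_zpow (a b : ℤ) :
    y p ^ a * z p ^ b = z p ^ b * y p ^ a * x p ^ (a * b) := by
  have h1 : y p ^ a * z p * (y p ^ a)⁻¹ = z p * x p ^ a := by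
    have hc : Commute (x p ^ a) (y p ^ a) :=
      ((show Commute (x p) (y p) from x_mul_y).zpow_zpow a a)
    rw [y_zpow_mul_z, mul_assoc (z p), ← hc.eq, ← mul_assoc, mul_inv_cancel_right]
  have hc : Commute (z p) (x p ^ a) :=
    (show Commute (z p) (x p) from x_mul_z.symm).zpow_right a
  have hxy : Commute (x p ^ (a * b)) (y p ^ a) :=
    ((show Commute (x p) (y p) from x_mul_y).zpow_zpow _ _)
  have h2 : y p ^ a * z p ^ b * (y p ^ a)⁻¹ = z p ^ b * x p ^ (a * b) := by
    rw [← conj_zpow, h1, hc.mul_zpow, zpow_mul]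
  calc y p ^ a * z p ^ b = (y p ^ a * z p ^ b * (y p ^ a)⁻¹) * y p ^ a := by group
    _ = _ := by rw [h2, mul_assoc, hxy.eq, mul_assoc]

end ExtraSpecial

open ExtraSpecial

/-- The admissible parameters: `p` is a prime with `p - 1 = 2 ^ (n - 1) * t`, where `n ≥ 3` and
`t` is odd (so that `p` is congruent to `1` modulo `4`), `r` is a primitive root modulo `p`, and
`r ^ t ≡ - k q` modulo `p`. -/
structure Admissible (p n t : ℕ) (r k q : ℤ) : Prop where
  prime : p.Prime
  three_le : 3 ≤ n
  odd : Odd t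
  eq_add_one : p = 2 ^ (n - 1) * t + 1
  primitive : orderOf (r : ZMod p) = p - 1
  cong : (r : ZMod p) ^ t = -((k : ZMod p) * (q : ZMod p))

variable {p n t : ℕ} {r k q : ℤ}

/-- The images of the generators under the automorphism `θ`. -/
def thetaGen (p t : ℕ) (r k q : ℤ) : Gen → ExtraSpecial p
  | Gen.x => x p ^ (r ^ t)
  | Gen.y => z p ^ k
  | Gen.z => y p ^ q

theorem thetaGen_rels (h : Admissible p n t r k q) :
    ∀ s ∈ rels p, FreeGroup.lift (thetaGen p t r k q) s = 1 := by
  have hxy : Commute (x p) (y p) := x_mul_y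
  have hxz : Commute (x p) (z p) := x_mul_z
  have aux : ∀ (g : ExtraSpecial p), g ^ p = 1 → ∀ a : ℤ, (g ^ a) ^ p = 1 := by
    intro g hg a
    rw [← zpow_natCast, ← zpow_mul, mul_comm, zpow_mul, zpow_natCast, hg, one_zpow]
  intro s hs
  simp only [rels, Set.mem_insert_iff, Set.mem_singleton_iff] at hs
  rcases hs with rfl | rfl | rfl | rfl | rfl | rfl
  · simpa [thetaGen] using aux _ x_pow _
  · simpa [thetaGen] using aux _ z_pow _
  · simpa [thetaGen] using aux _ y_pow _
  · simp only [map_mul, map_inv, FreeGroup.lift_apply_of, thetaGen, mul_inv_eq_one]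
    exact (hxz.zpow_zpow (r ^ t) k).eq
  · have h1 : x p ^ (r ^ t) = x p ^ (-(q * k)) :=
      zpow_congr x_pow (by push_cast; rw [h.cong]; ring)
    have h2 := y_zpow_mul_z_zpow (p := p) q k
    simp only [map_mul, map_inv, FreeGroup.lift_apply_of, thetaGen, mul_inv_eq_one]
    rw [h1, h2, mul_assoc, ← zpow_add, add_neg_cancel, zpow_zero, mul_one]
  · simp only [map_mul, map_inv, FreeGroup.lift_apply_of, thetaGen, mul_inv_eq_one]
    exact (hxy.zpow_zpow (r ^ t) q).eq

/-- The endomorphism `θ` with `x ↦ x ^ (r ^ t)`, `y ↦ z ^ k`, `z ↦ y ^ q`. -/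
def thetaHom (h : Admissible p n t r k q) : Monoid.End (ExtraSpecial p) :=
  PresentedGroup.toGroup (f := thetaGen p t r k q) (thetaGen_rels h)

theorem thetaHom_x (h : Admissible p n t r k q) : thetaHom h (x p) = x p ^ (r ^ t) :=
  PresentedGroup.toGroup.of (thetaGen_rels h)

theorem thetaHom_y (h : Admissible p n t r k q) : thetaHom h (y p) = z p ^ k :=
  PresentedGroup.toGroup.of (thetaGen_rels h)

theorem thetaHom_z (h : Admissible p n t r k q) : thetaHom h (z p) = y p ^ q :=
  PresentedGroup.toGroup.of (thetaGen_rels h)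

theorem end_mul_apply {G : Type*} [Group G] (f f' : Monoid.End G) (g : G) :
    (f * f') g = f (f' g) := rfl

theorem end_pow_apply {G : Type*} [Group G] (f : Monoid.End G) {g : G} {a : ℤ}
    (hf : f g = g ^ a) (m : ℕ) : (f ^ m) g = g ^ (a ^ m) := by
  induction m with
  | zero => simp
  | succ m ih =>
    rw [pow_succ', end_mul_apply, ih, map_zpow, hf, ← zpow_mul, ← pow_succ']

theorem thetaHom_pow (h : Admissible p n t r k q) : thetaHom h ^ (2 ^ n) = 1 := by
  have hp := h.prime
  have hpos : 2 ^ n = 2 * 2 ^ (n - 1) := by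
    rw [← pow_succ', Nat.sub_add_cancel (by have := h.three_le; omega)]
  have hr : (r : ZMod p) ^ (t * 2 ^ (n - 1)) = 1 := by
    have h1 : t * 2 ^ (n - 1) = p - 1 := by rw [mul_comm]; have := h.eq_add_one; omega
    rw [h1, ← h.primitive, pow_orderOf_eq_one]
  have hkq : (k : ZMod p) * (q : ZMod p) = -((r : ZMod p) ^ t) := by rw [h.cong, neg_neg]
  have heven : Even (2 ^ (n - 1)) :=
    (even_two).pow_of_ne_zero (by have := h.three_le; omega)
  have key : ((k : ZMod p) * (q : ZMod p)) ^ 2 ^ (n - 1) = 1 := by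
    rw [hkq, heven.neg_pow, ← pow_mul, hr]
  have hx : (thetaHom h ^ 2) (x p) = x p ^ ((r ^ t) ^ 2) := end_pow_apply _ (thetaHom_x h) 2
  have hy : (thetaHom h ^ 2) (y p) = y p ^ (k * q) := by
    rw [pow_two, end_mul_apply, thetaHom_y, map_zpow, thetaHom_z, ← zpow_mul, mul_comm q]
  have hz : (thetaHom h ^ 2) (z p) = z p ^ (k * q) := by
    rw [pow_two, end_mul_apply, thetaHom_z, map_zpow, thetaHom_y, ← zpow_mul]
  rw [hpos, pow_mul]
  refine PresentedGroup.ext ?_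
  intro g
  cases g with
  | x =>
    change ((thetaHom h ^ 2) ^ 2 ^ (n - 1)) (x p) = x p
    rw [end_pow_apply _ hx]
    conv_rhs => rw [← zpow_one (x p)]
    refine zpow_congr x_pow ?_
    push_cast
    rw [← pow_mul, ← pow_mul, show t * (2 * 2 ^ (n - 1)) = t * 2 ^ (n - 1) * 2 by ring, pow_mul, hr,
      one_pow]
  | y =>
    change ((thetaHom h ^ 2) ^ 2 ^ (n - 1)) (y p) = y p
    rw [end_pow_apply _ hy]
    conv_rhs => rw [← zpow_one (y p)]
    exact zpow_congr y_pow (by push_cast; exact key)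
  | z =>
    change ((thetaHom h ^ 2) ^ 2 ^ (n - 1)) (z p) = z p
    rw [end_pow_apply _ hz]
    conv_rhs => rw [← zpow_one (z p)]
    exact zpow_congr z_pow (by push_cast; exact key)

/-- The automorphism `θ` of the extraspecial group. -/
def theta (h : Admissible p n t r k q) : MulAut (ExtraSpecial p) :=
  MonoidHom.toMulEquiv (thetaHom h) (thetaHom h ^ (2 ^ n - 1))
    (by
      change thetaHom h ^ (2 ^ n - 1) * thetaHom h = 1
      rw [← pow_succ, Nat.sub_add_cancel Nat.one_le_two_pow, thetaHom_pow])
    (by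
      change thetaHom h * thetaHom h ^ (2 ^ n - 1) = 1
      rw [← pow_succ', Nat.sub_add_cancel Nat.one_le_two_pow, thetaHom_pow])

theorem theta_apply (h : Admissible p n t r k q) (g : ExtraSpecial p) :
    theta h g = thetaHom h g := rfl

theorem theta_pow (h : Admissible p n t r k q) : theta h ^ (2 ^ n) = 1 := by
  have key : ∀ (m : ℕ) (g : ExtraSpecial p), (theta h ^ m) g = (thetaHom h ^ m) g := by
    intro m
    induction m with
    | zero => intro g; rfl
    | succ m ih =>
      intro g
      rw [pow_succ, pow_succ, MulAut.mul_apply, end_mul_apply, ih]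
      rfl
  ext g
  rw [key, thetaHom_pow]
  rfl

/-- The cyclic group of order `2 ^ n`, written multiplicatively. -/
abbrev Cyc (n : ℕ) : Type := Multiplicative (ZMod (2 ^ n))

/-- The action of the cyclic group in which the generator acts by `θ⁻¹`. In the semidirect
product the generator `w` then satisfies `w⁻¹ g w = θ g` for `g` in the extraspecial group. -/
def action (h : Admissible p n t r k q) : Cyc n →* MulAut (ExtraSpecial p) :=
  AddMonoidHom.toMultiplicativeLeft
    (ZMod.lift (2 ^ n) (A := Additive (MulAut (ExtraSpecial p)))
      ⟨zmultiplesHom (Additive (MulAut (ExtraSpecial p))) (Additive.ofMul (theta h)⁻¹), by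
        rw [zmultiplesHom_apply, natCast_zsmul, ← ofMul_pow, inv_pow, theta_pow, inv_one,
          ofMul_one]⟩)

/-- The group `G` of order `p ^ 3 * 2 ^ n`: the semidirect product of the extraspecial group with
the cyclic group of order `2 ^ n`. -/
abbrev G (h : Admissible p n t r k q) : Type := ExtraSpecial p ⋊[action h] Cyc n

/-- The element `x` of `G`. -/
def gx (h : Admissible p n t r k q) : G h := SemidirectProduct.inl (x p)

/-- The element `y` of `G`. -/
def gy (h : Admissible p n t r k q) : G h := SemidirectProduct.inl (y p)

/-- The element `z` of `G`. -/
def gz (h : Admissible p n t r k q) : G h := SemidirectProduct.inl (z p)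

/-- The element `w` of `G`. -/
def gw (h : Admissible p n t r k q) : G h := SemidirectProduct.inr (Multiplicative.ofAdd 1)

theorem action_gen (h : Admissible p n t r k q) :
    action h (Multiplicative.ofAdd 1) = (theta h)⁻¹ := by
  have h1 : (1 : ZMod (2 ^ n)) = ((1 : ℤ) : ZMod (2 ^ n)) := by simp
  change Additive.toMul (ZMod.lift (2 ^ n) _ (1 : ZMod (2 ^ n))) = (theta h)⁻¹
  rw [h1, ZMod.lift_coe]
  simp

/-- The relations that tie `w` to the extraspecial group. -/
theorem conj_w (h : Admissible p n t r k q) (g : ExtraSpecial p) :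
    (gw h)⁻¹ * SemidirectProduct.inl g * gw h = SemidirectProduct.inl (theta h g) := by
  rw [gw, ← map_inv, ← SemidirectProduct.inl_aut_inv, action_gen, inv_inv]

/-- The normal subgroup `P` of `G`. -/
def P (h : Admissible p n t r k q) : Subgroup (G h) := SemidirectProduct.inl.range

/-- The subgroup `Q` of `G` generated by `x`, `y` and `w ^ (2 ^ (n - 1))`. -/
def Q (h : Admissible p n t r k q) : Subgroup (G h) :=
  Subgroup.closure {gx h, gy h, gw h ^ 2 ^ (n - 1)}

theorem gx_mem_Q (h : Admissible p n t r k q) : gx h ∈ Q h :=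
  Subgroup.subset_closure (by simp)

end GpTwo

/-- The set of complex irreducible characters of a group. -/
def IrrChar (G : Type) [Group G] : Set (G → ℂ) :=
  { χ | ∃ (V : Type) (_ : AddCommGroup V) (_ : Module ℂ V) (_ : FiniteDimensional ℂ V)
      (ρ : Representation ℂ G V), ρ.IsIrreducible ∧ ρ.character = χ }

/-- The one-dimensional representation with a given linear character. -/
def linRep {G : Type} [Group G] (φ : G →* ℂˣ) : Representation ℂ G ℂ :=
  (Algebra.lmul ℂ ℂ).toMonoidHom.comp ((Units.coeHom ℂ).comp φ)

/-- The character of `G` induced from a linear character of a subgroup `H`. -/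
noncomputable def indChar {G : Type} [Group G] (H : Subgroup G) (φ : H →* ℂˣ) : G → ℂ :=
  (Representation.ind H.subtype (linRep φ)).character

namespace GpTwo

variable {p n t : ℕ} {r k q : ℤ}

/-- The characters of `G` induced from the non-principal linear characters of `P`. -/
def familyP (h : Admissible p n t r k q) : Set (G h → ℂ) :=
  { χ | ∃ φ : P h →* ℂˣ, φ ≠ 1 ∧ χ = indChar (P h) φ }

/-- The characters of `G` induced from the linear characters of `Q` that do not have `x` in their
kernel. -/
def familyQ (h : Admissible p n t r k q) : Set (G h → ℂ) :=
  { χ | ∃ ψ : Q h →* ℂˣ, ψ ⟨gx h, gx_mem_Q h⟩ ≠ 1 ∧ χ = indChar (Q h) ψ }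

end GpTwo

/-! ### Joint eigenvectors, Frobenius reciprocity and induced characters. -/

section RepresentationTheory

open Representation Module

/-! No sum-of-squares count is needed: each nonlinear irreducible representation is recognised
directly as an induced one. Let `V` be irreducible and let a subgroup `H` act on a nonzero vector
through a linear character `φ`. Frobenius reciprocity maps the representation induced from `φ` onto
`V`, so dim `V` is at most the index of `H`. If `V` contains that many independent vectors, the map
is an isomorphism (`character_eq_indChar`). The independent vectors are joint eigenvectors with
distinct eigenvalue systems, so the work consists in following eigenvalues under `w` and `z`.
Conversely every `φ` occurs in some irreducible representation (`exists_irreducible_isEigen`), which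
makes the members of both families irreducible.

Write u = r^t and s = w^(2^(n-1)). Modulo p both u and kq have 2^(n-2)-th power -1, so s centralises
x and inverts y and z. If x fixes a nonzero vector of an irreducible `V`, it acts trivially, and y,
z have a joint eigenvector whose eigenvalues form a pair of p-th roots of unity. The trivial pair
forces dim `V` = 1. Any other pair has an orbit of length 2^n under w, because half a turn is
inversion and p is odd; this gives family (a). If x has an eigenvalue ω ≠ 1, its eigenspace contains
a vector fixed by y on which s acts by a sign. Then w moves ω through 2^(n-1) values, and over each
value the powers of z give p eigenvalues of y; this gives family (b).

The eigenvectors so found form a basis, so two induced characters agree exactly when their data lie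
in one orbit (`indChar_charP_eq_iff`, `indChar_charQ_eq_iff`). Constant orbit length gives the
counts, and the degrees separate the families. -/

theorem linearIndependent_of_joint_eigenvectors {κ ι V : Type*} [AddCommGroup V] [Module ℂ V]
    (T : κ → Module.End ℂ V) (χ : ι → κ → ℂ) (hχ : Function.Injective χ) (v : ι → V)
    (hv : ∀ i, v i ≠ 0) (hT : ∀ i j, T j (v i) = χ i j • v i) : LinearIndependent ℂ v := by
  classical
  rw [linearIndependent_iff']
  intro s
  induction s using Finset.induction_on with
  | empty => simp
  | insert a s ha ih =>
    intro c hc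
    have hs : ∀ i ∈ s, c i = 0 := by
      intro i hi
      obtain ⟨j, hj⟩ : ∃ j, χ i j ≠ χ a j := by
        by_contra! hcon
        exact ha (hχ (funext hcon) ▸ hi)
      -- Applying `T j - χ a j` kills the `a`-term and rescales the others, so the induction
      -- hypothesis applies.
      have h2 : ∑ i ∈ s, (c i * (χ i j - χ a j)) • v i = 0 := by
        have h3 := congrArg (fun w => T j w - χ a j • w) hc
        simp only [map_sum, map_smul, hT, Finset.smul_sum, map_zero, smul_zero, sub_zero] at h3
        rw [← Finset.sum_sub_distrib, Finset.sum_insert ha] at h3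
        rw [← h3]
        have : c a • χ a j • v a - χ a j • c a • v a = 0 := by
          rw [smul_comm, sub_self]
        rw [this, zero_add]
        refine Finset.sum_congr rfl fun i _ => ?_
        module
      have := ih _ h2 i hi
      exact (mul_eq_zero.1 this).resolve_right (sub_ne_zero.2 hj)
    intro i hi
    rcases Finset.mem_insert.1 hi with rfl | hi
    · rw [Finset.sum_insert ha, Finset.sum_eq_zero (fun j hj => by rw [hs j hj, zero_smul]),
        add_zero] at hc
      exact (smul_eq_zero.1 hc).resolve_right (hv _)
    · exact hs i hi

/-- The `v i` form a basis, and a nonzero coordinate of `v'` at `i` forces `χ i = χ'`; injectivity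
of `χ` leaves one such `i`. Hence a full orbit of eigenvectors exhausts the eigenvalue systems of
the space, each on a single line. -/
theorem eq_smul_of_joint_eigenvector {κ ι V : Type*} [Fintype ι] [AddCommGroup V] [Module ℂ V]
    [FiniteDimensional ℂ V]
    (T : κ → Module.End ℂ V) (χ : ι → κ → ℂ) (hχ : Function.Injective χ) (v : ι → V)
    (hv : ∀ i, v i ≠ 0) (hT : ∀ i j, T j (v i) = χ i j • v i)
    (hcard : Fintype.card ι = finrank ℂ V) (χ' : κ → ℂ) (v' : V) (hv' : v' ≠ 0)
    (hT' : ∀ j, T j v' = χ' j • v') : ∃ i, χ i = χ' ∧ ∃ c : ℂ, v' = c • v i := by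
  classical
  have hli := linearIndependent_of_joint_eigenvectors T χ hχ v hv hT
  let b := basisOfLinearIndependentOfCardEqFinrank' v hli hcard
  have hb : ∀ i, b i = v i := fun i => by simp [b]
  have hrep := b.sum_repr v'
  have hzero : ∀ i, b.repr v' i ≠ 0 → χ i = χ' := by
    intro i hi
    funext j
    have h1 : ∑ i, (b.repr v' i * (χ i j - χ' j)) • v i = 0 := by
      have h2 := hT' j
      rw [← sub_eq_zero] at h2
      rw [← hrep, map_sum, Finset.smul_sum, ← Finset.sum_sub_distrib] at h2
      rw [← h2]
      refine Finset.sum_congr rfl fun i _ => ?_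
      rw [map_smul, hb, hT]
      module
    have := (Fintype.linearIndependent_iff.1 hli) _ h1 i
    exact sub_eq_zero.1 ((mul_eq_zero.1 this).resolve_left hi)
  obtain ⟨i, hi⟩ : ∃ i, b.repr v' i ≠ 0 := by
    by_contra! hcon
    apply hv'
    rw [← hrep]
    exact Finset.sum_eq_zero fun i _ => by rw [hcon, zero_smul]
  refine ⟨i, hzero i hi, b.repr v' i, ?_⟩
  conv_lhs => rw [← hrep]
  rw [Finset.sum_eq_single i, hb]
  · intro j _ hji
    by_cases hj : b.repr v' j = 0
    · rw [hj, zero_smul]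
    · exact absurd (hχ ((hzero j hj).trans (hzero i hi).symm)) hji
  · simp

theorem exists_eigenvector_mem {V : Type*} [AddCommGroup V] [Module ℂ V] [FiniteDimensional ℂ V]
    (f : Module.End ℂ V) (W : Submodule ℂ V) (hW : W ≠ ⊥) (hf : ∀ v ∈ W, f v ∈ W) :
    ∃ v ∈ W, v ≠ 0 ∧ ∃ μ : ℂ, f v = μ • v := by
  have : Nontrivial W := (Submodule.nontrivial_iff_ne_bot).2 hW
  obtain ⟨μ, hμ⟩ := Module.End.exists_eigenvalue (f.restrict hf)
  obtain ⟨v, hv⟩ := hμ.exists_hasEigenvector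
  refine ⟨v, v.2, by simpa using hv.2, μ, ?_⟩
  have := congrArg Subtype.val hv.apply_eq_smul
  simpa using this

variable {G : Type} [Group G]

section

variable {V : Type*} [AddCommGroup V] [Module ℂ V] (ρ : Representation ℂ G V)

theorem Representation.IsIrreducible.eq_top_of_invariant (hρ : ρ.IsIrreducible)
    (W : Submodule ℂ V) (hW : ∀ g, ∀ v ∈ W, ρ g v ∈ W) (hne : W ≠ ⊥) : W = ⊤ := by
  let W' : Subrepresentation ρ := ⟨W, fun g v hv => hW g v hv⟩
  rcases hρ.eq_bot_or_eq_top W' with h | h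
  · exact absurd (congrArg Subrepresentation.toSubmodule h) hne
  · exact congrArg Subrepresentation.toSubmodule h

theorem Representation.isIrreducible_of_invariant [Nontrivial V]
    (hρ : ∀ W : Submodule ℂ V, (∀ g, ∀ v ∈ W, ρ g v ∈ W) → W = ⊥ ∨ W = ⊤) :
    ρ.IsIrreducible where
  exists_pair_ne := by
    refine ⟨⊥, ⊤, fun h => ?_⟩
    exact bot_ne_top (congrArg Subrepresentation.toSubmodule h : (⊥ : Submodule ℂ V) = ⊤)
  eq_bot_or_eq_top W := by
    rcases hρ W.toSubmodule (fun g v hv => W.apply_mem_toSubmodule g hv) with h | h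
    · exact Or.inl (Subrepresentation.toSubmodule_injective h)
    · exact Or.inr (Subrepresentation.toSubmodule_injective h)

theorem Representation.IsIrreducible.nontrivial_space (hρ : ρ.IsIrreducible) : Nontrivial V := by
  by_contra hcon
  rw [not_nontrivial_iff_subsingleton] at hcon
  obtain ⟨a, b, hab⟩ := hρ.exists_pair_ne
  exact hab (Subrepresentation.toSubmodule_injective (Subsingleton.elim _ _))

/-- A nonzero vector on which a subgroup acts through a given linear character. -/
def IsEigen (H : Subgroup G) (φ : H →* ℂˣ) (v : V) : Prop :=
  v ≠ 0 ∧ ∀ g : H, ρ (g : G) v = (φ g : ℂ) • v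

theorem exists_hom_of_eigenvector (S : Set G) (v : V) (hv : v ≠ 0)
    (hS : ∀ g ∈ S, ∃ c : ℂ, ρ g v = c • v) :
    ∃ φ : Subgroup.closure S →* ℂˣ, IsEigen ρ (Subgroup.closure S) φ v := by
  have unit : ∀ g : G, ∀ c : ℂ, ρ g v = c • v → c ≠ 0 := by
    rintro g c hc rfl
    rw [zero_smul] at hc
    apply hv
    rw [← ρ.inv_self_apply g v, hc, map_zero]
  have key : ∀ g : Subgroup.closure S, ∃ c : ℂˣ, ρ (g : G) v = (c : ℂ) • v := by
    rintro ⟨g, hg⟩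
    suffices h : ∃ c : ℂ, ρ g v = c • v by
      obtain ⟨c, hc⟩ := h
      exact ⟨Units.mk0 c (unit g c hc), hc⟩
    induction hg using Subgroup.closure_induction with
    | mem g hg => exact hS g hg
    | one => exact ⟨1, by simp⟩
    | mul a b _ _ ha hb =>
      obtain ⟨c, hc⟩ := ha
      obtain ⟨d, hd⟩ := hb
      exact ⟨c * d, by rw [map_mul, Module.End.mul_apply, hd, map_smul, hc, smul_smul, mul_comm]⟩
    | inv a _ ha =>
      obtain ⟨c, hc⟩ := ha
      refine ⟨c⁻¹, ?_⟩
      rw [ρ.inv_apply_eq_iff, map_smul, hc, smul_smul, inv_mul_cancel₀ (unit a c hc), one_smul]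
  choose φ hφ using key
  refine ⟨MonoidHom.mk' φ fun a b => ?_, hv, hφ⟩
  have h1 := hφ (a * b)
  rw [Subgroup.coe_mul, map_mul, Module.End.mul_apply, hφ b, map_smul, hφ a, smul_smul] at h1
  have := smul_left_injective ℂ hv h1
  ext
  rw [← this, Units.val_mul, mul_comm]

theorem isEigen_closure_of_generators (S : Set G) (φ : Subgroup.closure S →* ℂˣ) (v : V)
    (hv : v ≠ 0)
    (hS : ∀ g (hg : g ∈ S), ρ g v = (φ ⟨g, Subgroup.subset_closure hg⟩ : ℂ) • v) :
    IsEigen ρ (Subgroup.closure S) φ v := by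
  obtain ⟨φ', hφ'⟩ := exists_hom_of_eigenvector ρ S v hv fun g hg => ⟨_, hS g hg⟩
  suffices h : φ' = φ by rwa [← h]
  refine MonoidHom.ext fun g => ?_
  obtain ⟨g, hg⟩ := g
  induction hg using Subgroup.closure_induction with
  | mem g hg =>
    have h1 := hφ'.2 ⟨g, Subgroup.subset_closure hg⟩
    ext
    exact smul_left_injective ℂ hv (h1.symm.trans (hS g hg))
  | one => exact (map_one φ').trans (map_one φ).symm
  | mul a b ha hb iha ihb =>
    exact (map_mul φ' ⟨a, ha⟩ ⟨b, hb⟩).trans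
      ((congrArg₂ (· * ·) iha ihb).trans (map_mul φ ⟨a, ha⟩ ⟨b, hb⟩).symm)
  | inv a ha iha =>
    exact (map_inv φ' ⟨a, ha⟩).trans ((congrArg _ iha).trans (map_inv φ ⟨a, ha⟩).symm)

end

/-- Induction on a bound `m` for the dimension. Given a proper nonzero invariant subspace `W`, the
eigenvector either lies in `W` or survives in the quotient by `W`, so complete reducibility is not
needed. -/
theorem exists_irreducible_of_isEigen (H : Subgroup G) (φ : H →* ℂˣ) (m : ℕ) :
    ∀ (V : Type) [AddCommGroup V] [Module ℂ V] [FiniteDimensional ℂ V]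
      (ρ : Representation ℂ G V) (v : V), finrank ℂ V ≤ m → IsEigen ρ H φ v →
    ∃ (W : Type) (_ : AddCommGroup W) (_ : Module ℂ W) (_ : FiniteDimensional ℂ W)
      (σ : Representation ℂ G W) (w : W), σ.IsIrreducible ∧ IsEigen σ H φ w := by
  induction m with
  | zero =>
    intro V _ _ _ ρ v hm hv
    have := finrank_zero_iff.1 (Nat.le_zero.1 hm)
    exact absurd (Subsingleton.elim _ _) hv.1
  | succ m ih =>
    intro V _ _ _ ρ v hm hv
    have : Nontrivial V := ⟨v, 0, hv.1⟩
    by_cases hirr : ∀ W : Submodule ℂ V, (∀ g, ∀ v ∈ W, ρ g v ∈ W) → W = ⊥ ∨ W = ⊤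
    · exact ⟨V, _, _, inferInstance, ρ, v, ρ.isIrreducible_of_invariant hirr, hv⟩
    push Not at hirr
    obtain ⟨W, hW, hbot, htop⟩ := hirr
    by_cases hvW : v ∈ W
    · refine ih W (ρ.subrepresentation W hW) ⟨v, hvW⟩ ?_ ⟨?_, fun g => ?_⟩
      · have := Submodule.finrank_lt htop
        omega
      · simpa using hv.1
      · exact Subtype.ext (hv.2 g)
    · refine ih (V ⧸ W) (ρ.quotient W hW) (W.mkQ v) ?_ ⟨?_, fun g => ?_⟩
      · have h1 := W.finrank_quotient_add_finrank
        have h2 : 0 < finrank ℂ W := by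
          have : Nontrivial W := Submodule.nontrivial_iff_ne_bot.2 hbot
          exact finrank_pos
        omega
      · simpa using hvW
      · exact congrArg W.mkQ (hv.2 g)

/-- In the right regular representation on functions, `φ` extended by zero outside `H` is an
eigenvector. -/
theorem exists_irreducible_isEigen [Finite G] (H : Subgroup G) (φ : H →* ℂˣ) :
    ∃ (W : Type) (_ : AddCommGroup W) (_ : Module ℂ W) (_ : FiniteDimensional ℂ W)
      (σ : Representation ℂ G W) (w : W), σ.IsIrreducible ∧ IsEigen σ H φ w := by
  classical
  let ρ : Representation ℂ G (G → ℂ) :=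
    { toFun := fun g => LinearMap.funLeft ℂ ℂ (· * g)
      map_one' := by ext; simp [LinearMap.funLeft]
      map_mul' := fun a b => by
        refine LinearMap.ext fun f => funext fun g => ?_
        simp [LinearMap.funLeft, mul_assoc] }
  let f : G → ℂ := fun g => if hg : g ∈ H then (φ ⟨g, hg⟩ : ℂ) else 0
  refine exists_irreducible_of_isEigen H φ _ (G → ℂ) ρ f le_rfl ⟨fun hf => ?_, fun a => ?_⟩
  · have := congrFun hf 1
    simp only [f, dif_pos H.one_mem, Pi.zero_apply] at this
    exact Units.ne_zero _ this
  · funext g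
    change f (g * a) = φ a * f g
    by_cases hg : g ∈ H
    · simp only [f, dif_pos hg, dif_pos (H.mul_mem hg a.2)]
      rw [mul_comm, ← Units.val_mul, ← map_mul]
      rfl
    · have : g * a ∉ H := fun hcon => hg ((H.mul_mem_cancel_right a.2).1 hcon)
      simp only [f, dif_neg hg, dif_neg this, mul_zero]

/-- The linear map from the induced representation given by Frobenius reciprocity. -/
noncomputable def indLift {V : Type*} [AddCommGroup V] [Module ℂ V] (ρ : Representation ℂ G V)
    (H : Subgroup G) (φ : H →* ℂˣ) (v : V) (hv : IsEigen ρ H φ v) :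
    IndV H.subtype (linRep φ) →ₗ[ℂ] V :=
  Coinvariants.lift _
    (TensorProduct.lift <| (Finsupp.lift _ _ _ fun g =>
      ρ g⁻¹ ∘ₗ LinearMap.toSpanSingleton ℂ V v) ∘ₗ
      (MonoidAlgebra.coeffLinearEquiv ℂ).toLinearMap)
    (fun g => by
      have := hv.2 g
      ext h
      simp [ofMulAction_single, mul_inv_rev, linRep]
      rw [← map_smul, ← map_smul, ← this, ρ.inv_self_apply])

theorem indLift_mk {V : Type*} [AddCommGroup V] [Module ℂ V] (ρ : Representation ℂ G V)
    (H : Subgroup G) (φ : H →* ℂˣ) (v : V) (hv : IsEigen ρ H φ v) (g : G) (c : ℂ) :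
    indLift ρ H φ v hv (IndV.mk _ _ g c) = c • ρ g⁻¹ v := by
  simp [indLift]

/-- Up to a scalar the generating vector at `g` depends only on a coset of `H`. Inverses appear
because `ind` acts by right multiplication by `g⁻¹`: the vector at `c⁻¹` is the `c`-translate of the
one at `1`. -/
theorem span_indV (H : Subgroup G) (φ : H →* ℂˣ) (T : Set G)
    (hT : ∀ g : G, ∃ c ∈ T, c⁻¹ * g ∈ H) :
    Submodule.span ℂ ((fun c : G => IndV.mk H.subtype (linRep φ) c⁻¹ 1) '' T) = ⊤ := by
  set S := Submodule.span ℂ ((fun c : G => IndV.mk H.subtype (linRep φ) c⁻¹ 1) '' T)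
  have h1 : S.mkQ = 0 := by
    refine IndV.hom_ext _ _ fun g => LinearMap.ext_ring ?_
    rw [LinearMap.zero_comp, LinearMap.zero_apply, LinearMap.comp_apply, Submodule.mkQ_apply,
      Submodule.Quotient.mk_eq_zero]
    obtain ⟨c, hc, hg⟩ := hT g⁻¹
    have h2 : IndV.mk H.subtype (linRep φ) g 1 =
        (φ ⟨_, hg⟩ : ℂ) • IndV.mk H.subtype (linRep φ) c⁻¹ 1 := by
      rw [← map_smul]
      have h3 := Coinvariants.mk_self_apply
        (Representation.tprod ((leftRegular ℂ G).comp H.subtype) (linRep φ)) ⟨_, hg⟩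
        (TensorProduct.tmul ℂ (MonoidAlgebra.single g 1) 1)
      simp [linRep, ofMulAction_single] at h3 ⊢
      exact h3.symm
    rw [h2]
    exact S.smul_mem _ (Submodule.subset_span ⟨c, hc, rfl⟩)
  rw [← S.ker_mkQ, h1, LinearMap.ker_zero]

/-- The induced space has dimension at most `Fintype.card ι` and maps onto `V` by irreducibility;
the opposite inequality `hcard` then leaves no room for a kernel. -/
theorem character_eq_indChar {V : Type*} [AddCommGroup V] [Module ℂ V] [FiniteDimensional ℂ V]
    (ρ : Representation ℂ G V) (hρ : ρ.IsIrreducible) (H : Subgroup G) (φ : H →* ℂˣ) (v : V)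
    (hv : IsEigen ρ H φ v) {ι : Type*} [Fintype ι] (c : ι → G)
    (hc : ∀ g : G, ∃ i, (c i)⁻¹ * g ∈ H) (hcard : Fintype.card ι ≤ finrank ℂ V) :
    finrank ℂ V = Fintype.card ι ∧ ρ.character = indChar H φ := by
  have hspan := span_indV H φ (Set.range c) (fun g => by simpa using hc g)
  rw [← Set.range_comp] at hspan
  have hfin : FiniteDimensional ℂ (IndV H.subtype (linRep φ)) :=
    ⟨(Submodule.fg_def.2 ⟨_, Set.finite_range _, hspan⟩)⟩
  have hle : finrank ℂ (IndV H.subtype (linRep φ)) ≤ Fintype.card ι := by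
    have := finrank_range_le_card (R := ℂ) ((fun c : G => IndV.mk H.subtype (linRep φ) c⁻¹ 1) ∘ c)
    rwa [Set.finrank, hspan, finrank_top] at this
  let F := indLift ρ H φ v hv
  have hF : ∀ g, F ∘ₗ ind H.subtype (linRep φ) g = ρ g ∘ₗ F := by
    intro g
    refine IndV.hom_ext _ _ fun a => LinearMap.ext_ring ?_
    simp only [LinearMap.comp_apply]
    have := ind_mk H.subtype (linRep φ) g a 1
    simp only [LinearMap.comp_apply] at this
    rw [this]
    have h1 := indLift_mk ρ H φ v hv (a * g⁻¹) 1
    have h2 := indLift_mk ρ H φ v hv a 1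
    simp only [LinearMap.comp_apply] at h1 h2
    rw [h1, h2, mul_inv_rev, inv_inv, map_mul, one_smul, one_smul, Module.End.mul_apply]
  have hsurj : LinearMap.range F = ⊤ := by
    refine hρ.eq_top_of_invariant ρ _ ?_ ?_
    · rintro g _ ⟨w, rfl⟩
      exact ⟨_, LinearMap.congr_fun (hF g) w⟩
    · intro hcon
      have h1 : F (IndV.mk _ _ 1 1) ∈ LinearMap.range F := ⟨_, rfl⟩
      rw [hcon, Submodule.mem_bot, indLift_mk] at h1
      simp only [inv_one, map_one, one_smul, Module.End.one_apply] at h1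
      exact hv.1 h1
  have h1 := LinearMap.finrank_range_add_finrank_ker F
  rw [hsurj, finrank_top] at h1
  refine ⟨by omega, ?_⟩
  have hker : LinearMap.ker F = ⊥ := Submodule.finrank_eq_zero.1 (by omega)
  let e := LinearEquiv.ofBijective F ⟨LinearMap.ker_eq_bot.1 hker, LinearMap.range_eq_top.1 hsurj⟩
  exact (char_iso (Representation.Equiv.mk e hF)).symm

/-- Orthonormality of characters: equal characters have inner product 1, not 0. -/
theorem nonempty_equiv_of_character_eq [Finite G] {V W : Type*} [AddCommGroup V] [Module ℂ V]
    [FiniteDimensional ℂ V] [AddCommGroup W] [Module ℂ W] [FiniteDimensional ℂ W]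
    (ρ : Representation ℂ G V) (σ : Representation ℂ G W) (hρ : ρ.IsIrreducible)
    (hσ : σ.IsIrreducible) (h : ρ.character = σ.character) :
    Nonempty (Representation.Equiv σ ρ) := by
  classical
  have := Fintype.ofFinite G
  have : Invertible (Nat.card G : ℂ) := invertibleOfNonzero (by simp)
  have h1 := char_orthonormal ρ σ
  have h2 := char_orthonormal ρ ρ
  rw [if_pos ⟨Representation.Equiv.refl ρ⟩] at h2
  rw [← h, h2] at h1
  by_contra hcon
  rw [if_neg hcon] at h1
  exact one_ne_zero h1

theorem isEigen_of_equiv {V W : Type*} [AddCommGroup V] [Module ℂ V] [AddCommGroup W] [Module ℂ W]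
    {ρ : Representation ℂ G V} {σ : Representation ℂ G W} (e : Representation.Equiv ρ σ)
    {H : Subgroup G} {φ : H →* ℂˣ} {v : V} (hv : IsEigen ρ H φ v) : IsEigen σ H φ (e v) := by
  refine ⟨fun h => hv.1 ?_, fun g => ?_⟩
  · exact e.toLinearEquiv.map_eq_zero_iff.1 h
  · have h1 : e (ρ g v) = σ g (e v) := LinearMap.congr_fun (e.toIntertwiningMap.isIntertwining' g) v
    rw [← h1, hv.2, map_smul]

end RepresentationTheory

/-- To be applied with orbits under conjugation by `w` as fibres. -/
theorem card_eq_mul_ncard_range {X Y : Type*} [Finite X] (f : X → Y) (N : ℕ)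
    (h : ∀ a, ∃ e : Fin N → X, Function.Injective e ∧ ∀ b, f b = f a ↔ ∃ i, e i = b) :
    Nat.card X = N * (Set.range f).ncard := by
  classical
  have := Fintype.ofFinite X
  rw [Nat.card_eq_fintype_card, ← Finset.card_univ, ← Set.image_univ, ← Finset.coe_univ,
    ← Finset.coe_image, Set.ncard_coe_finset]
  rw [Finset.card_eq_sum_card_image f, Finset.sum_const_nat (m := N), mul_comm]
  simp only [Finset.mem_image, Finset.mem_univ, true_and, forall_exists_index,
    forall_apply_eq_imp_iff]
  intro a
  obtain ⟨e, he, hf⟩ := h a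
  have : (Finset.univ.filter fun b => f b = f a) = Finset.univ.image e := by
    ext b
    simp [hf]
  rw [this, Finset.card_image_of_injective _ he, Finset.card_univ, Fintype.card_fin]

/-! ### Normal forms, nontriviality of x, and coset representatives. -/

namespace GpTwo

namespace ExtraSpecial

/-- Collection: `x` is central, and moving y^b past z^c costs x^(bc). -/
theorem exists_zpow_form {p : ℕ} (g : ExtraSpecial p) :
    ∃ a b c : ℤ, g = z p ^ c * y p ^ b * x p ^ a := by
  have hxy : ∀ a b : ℤ, x p ^ a * y p ^ b = y p ^ b * x p ^ a := fun a b =>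
    ((show Commute (x p) (y p) from x_mul_y).zpow_zpow a b).eq
  have hxz : ∀ a b : ℤ, x p ^ a * z p ^ b = z p ^ b * x p ^ a := fun a b =>
    ((show Commute (x p) (z p) from x_mul_z).zpow_zpow a b).eq
  have hg : g ∈ Subgroup.closure (Set.range (PresentedGroup.of : Gen → ExtraSpecial p)) := by
    rw [PresentedGroup.closure_range_of]
    trivial
  induction hg using Subgroup.closure_induction with
  | mem g hg =>
    obtain ⟨s, rfl⟩ := hg
    cases s with
    | x => exact ⟨1, 0, 0, by simp [x]⟩
    | y => exact ⟨0, 1, 0, by simp [y]⟩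
    | z => exact ⟨0, 0, 1, by simp [z]⟩
  | one => exact ⟨0, 0, 0, by simp⟩
  | mul g g' _ _ hg hg' =>
    obtain ⟨a, b, c, rfl⟩ := hg
    obtain ⟨a', b', c', rfl⟩ := hg'
    refine ⟨b * c' + (a + a'), b + b', c + c', ?_⟩
    calc z p ^ c * y p ^ b * x p ^ a * (z p ^ c' * y p ^ b' * x p ^ a')
        = z p ^ c * y p ^ b * (x p ^ a * z p ^ c') * y p ^ b' * x p ^ a' := by group
      _ = z p ^ c * (y p ^ b * z p ^ c') * (x p ^ a * y p ^ b') * x p ^ a' := by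
        rw [hxz]; simp only [mul_assoc]
      _ = z p ^ c * z p ^ c' * y p ^ b * (x p ^ (b * c') * y p ^ b') * x p ^ a * x p ^ a' := by
        rw [y_zpow_mul_z_zpow, hxy a]; simp only [mul_assoc]
      _ = _ := by rw [hxy]; simp only [zpow_add, mul_assoc]
  | inv g _ hg =>
    obtain ⟨a, b, c, rfl⟩ := hg
    refine ⟨b * c - a, -b, -c, ?_⟩
    calc (z p ^ c * y p ^ b * x p ^ a)⁻¹ = x p ^ (-a) * (y p ^ (-b) * z p ^ (-c)) := by group
      _ = x p ^ (-a) * z p ^ (-c) * y p ^ (-b) * x p ^ (b * c) := by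
        rw [y_zpow_mul_z_zpow, neg_mul_neg]; simp only [mul_assoc]
      _ = z p ^ (-c) * (x p ^ (-a) * y p ^ (-b)) * x p ^ (b * c) := by
        rw [hxz]; simp only [mul_assoc]
      _ = _ := by rw [hxy, sub_eq_neg_add, zpow_add]; simp only [mul_assoc]

theorem zpow_eq_pow_val {p : ℕ} [NeZero p] {G : Type*} [Group G] {g : G} (hg : g ^ p = 1) (a : ℤ) :
    g ^ a = g ^ (a : ZMod p).val := by
  rw [← zpow_natCast]
  exact zpow_congr hg (by simp)

theorem exists_pow_form {p : ℕ} [NeZero p] (g : ExtraSpecial p) :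
    ∃ a b c : ZMod p, g = z p ^ c.val * y p ^ b.val * x p ^ a.val := by
  obtain ⟨a, b, c, h⟩ := exists_zpow_form g
  exact ⟨a, b, c, by rw [h, zpow_eq_pow_val x_pow, zpow_eq_pow_val y_pow, zpow_eq_pow_val z_pow]⟩

instance finite {p : ℕ} [NeZero p] : Finite (ExtraSpecial p) :=
  Finite.of_surjective
    (fun a : ZMod p × ZMod p × ZMod p => z p ^ a.2.2.val * y p ^ a.2.1.val * x p ^ a.1.val)
    fun g => by
      obtain ⟨a, b, c, h⟩ := exists_pow_form g
      exact ⟨(a, b, c), h.symm⟩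

/-- The images of the generators under the action on the plane over `ZMod p` by shears and
translations. -/
def planeGen (p : ℕ) : Gen → Equiv.Perm (ZMod p × ZMod p)
  | Gen.x => ⟨fun a => (a.1, a.2 + 1), fun a => (a.1, a.2 - 1), fun a => by simp, fun a => by simp⟩
  | Gen.y => ⟨fun a => (a.1, a.2 + a.1), fun a => (a.1, a.2 - a.1), fun a => by simp,
      fun a => by simp⟩
  | Gen.z => ⟨fun a => (a.1 + 1, a.2), fun a => (a.1 - 1, a.2), fun a => by simp, fun a => by simp⟩

theorem planeGen_rels (p : ℕ) : ∀ s ∈ rels p, FreeGroup.lift (planeGen p) s = 1 := by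
  have hx : ∀ (m : ℕ) (a : ZMod p × ZMod p), (planeGen p Gen.x ^ m) a = (a.1, a.2 + m) := by
    intro m
    induction m with
    | zero => simp
    | succ m ih => intro a; rw [pow_succ', Equiv.Perm.mul_apply, ih]; simp [planeGen, add_assoc]
  have hy : ∀ (m : ℕ) (a : ZMod p × ZMod p), (planeGen p Gen.y ^ m) a = (a.1, a.2 + m * a.1) := by
    intro m
    induction m with
    | zero => simp
    | succ m ih =>
      intro a; rw [pow_succ', Equiv.Perm.mul_apply, ih]; simp [planeGen, add_assoc, add_mul]
  have hz : ∀ (m : ℕ) (a : ZMod p × ZMod p), (planeGen p Gen.z ^ m) a = (a.1 + m, a.2) := by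
    intro m
    induction m with
    | zero => simp
    | succ m ih => intro a; rw [pow_succ', Equiv.Perm.mul_apply, ih]; simp [planeGen, add_assoc]
  intro s hs
  simp only [rels, Set.mem_insert_iff, Set.mem_singleton_iff] at hs
  rcases hs with rfl | rfl | rfl | rfl | rfl | rfl
  · ext1 a; simp [hx]
  · ext1 a; simp [hy]
  · ext1 a; simp [hz]
  all_goals
    simp only [map_mul, map_inv, FreeGroup.lift_apply_of, mul_inv_eq_one]
    ext1 a
    refine Prod.ext ?_ ?_ <;> simp only [planeGen, Equiv.Perm.mul_apply, Equiv.coe_fn_mk] <;> ring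

/-- The presentation alone does not exclude collapse; in the plane model `x` is a nontrivial
translation. -/
theorem x_ne_one {p : ℕ} [Fact p.Prime] : x p ≠ 1 := by
  intro h
  have h1 := congrArg (PresentedGroup.toGroup (planeGen_rels p)) h
  rw [map_one, show PresentedGroup.toGroup (planeGen_rels p) (x p) = planeGen p Gen.x from
    PresentedGroup.toGroup.of _] at h1
  have h2 := congrArg Prod.snd (Equiv.congr_fun h1 (0, 0))
  simp [planeGen] at h2

end ExtraSpecial

open ExtraSpecial

variable {p n t : ℕ} {r k q : ℤ}

namespace Admissible

variable (h : Admissible p n t r k q)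
include h

theorem fact_prime : Fact p.Prime := ⟨h.prime⟩

theorem two_pow_eq : (2 : ℕ) ^ (n - 1) = 2 ^ (n - 2) * 2 := by
  rw [← pow_succ]
  congr 1
  have := h.three_le
  omega

theorem two_pow_eq' : (2 : ℕ) ^ n = 2 ^ (n - 1) * 2 := by
  rw [← pow_succ]
  congr 1
  have := h.three_le
  omega

theorem two_lt : 2 < p := by
  have h1 := h.eq_add_one
  have h2 : 2 ^ 2 ≤ 2 ^ (n - 1) := Nat.pow_le_pow_right (by norm_num) (by have := h.three_le; omega)
  have h3 : 1 ≤ t := h.odd.pos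
  nlinarith

theorem neg_one_ne_one : (-1 : ZMod p) ≠ 1 := by
  have := h.fact_prime
  have : Fact (2 < p) := ⟨h.two_lt⟩
  exact ZMod.neg_one_ne_one

/-- The square is r^(p-1) = 1, and the value is not 1 because `r` has order p - 1, twice the
exponent t·2^(n-2). -/
theorem u_pow : ((r : ZMod p) ^ t) ^ 2 ^ (n - 2) = -1 := by
  have := h.fact_prime
  have h1 : t * 2 ^ (n - 2) * 2 = p - 1 := by
    have := h.eq_add_one
    rw [h.two_pow_eq] at this
    rw [mul_assoc, mul_comm]
    omega
  rw [← pow_mul]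
  have h2 : (r : ZMod p) ^ (t * 2 ^ (n - 2)) * (r : ZMod p) ^ (t * 2 ^ (n - 2)) = 1 := by
    rw [← pow_two, ← pow_mul, h1, ← h.primitive, pow_orderOf_eq_one]
  rcases mul_self_eq_one_iff.1 h2 with h3 | h3
  · have h4 := orderOf_dvd_of_pow_eq_one h3
    rw [h.primitive, ← h1] at h4
    have h5 : 0 < t * 2 ^ (n - 2) := Nat.mul_pos h.odd.pos (by positivity)
    have := Nat.le_of_dvd h5 h4
    omega
  · exact h3

/-- Here kq = -u, and n ≥ 3 makes 2^(n-2) even, so the sign disappears. -/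
theorem kq_pow : ((k : ZMod p) * (q : ZMod p)) ^ 2 ^ (n - 2) = -1 := by
  have heven : Even (2 ^ (n - 2)) :=
    (even_two).pow_of_ne_zero (by have := h.three_le; omega)
  rw [← neg_neg ((k : ZMod p) * q), ← h.cong, heven.neg_pow, h.u_pow]

end Admissible

/-- The square of θ raises y and z to the power kq and x to the power u^2; iterate it 2^(n-2) times.
-/
theorem theta_pow_apply_inv (h : Admissible p n t r k q) :
    (theta h ^ 2 ^ (n - 1)) (x p) = x p ∧ (theta h ^ 2 ^ (n - 1)) (y p) = (y p)⁻¹ ∧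
      (theta h ^ 2 ^ (n - 1)) (z p) = (z p)⁻¹ := by
  have key : ∀ (m : ℕ) (g : ExtraSpecial p), (theta h ^ m) g = (thetaHom h ^ m) g := by
    intro m
    induction m with
    | zero => intro g; rfl
    | succ m ih =>
      intro g
      rw [pow_succ, pow_succ, MulAut.mul_apply, end_mul_apply, ih]
      rfl
  have hx : (thetaHom h ^ 2) (x p) = x p ^ ((r ^ t) ^ 2) := end_pow_apply _ (thetaHom_x h) 2
  have hy : (thetaHom h ^ 2) (y p) = y p ^ (k * q) := by
    rw [pow_two, end_mul_apply, thetaHom_y, map_zpow, thetaHom_z, ← zpow_mul, mul_comm q]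
  have hz : (thetaHom h ^ 2) (z p) = z p ^ (k * q) := by
    rw [pow_two, end_mul_apply, thetaHom_z, map_zpow, thetaHom_y, ← zpow_mul]
  rw [key, key, key, h.two_pow_eq, mul_comm, pow_mul, end_pow_apply _ hx, end_pow_apply _ hy,
    end_pow_apply _ hz, ← zpow_neg_one, ← zpow_neg_one]
  refine ⟨?_, zpow_congr y_pow ?_, zpow_congr z_pow ?_⟩
  · conv_rhs => rw [← zpow_one (x p)]
    refine zpow_congr x_pow ?_
    push_cast
    rw [pow_right_comm, h.u_pow]
    ring
  · push_cast
    exact h.kq_pow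
  · push_cast
    exact h.kq_pow

section Relations

variable (h : Admissible p n t r k q)

/-- The involution `w ^ (2 ^ (n - 1))` of `G`. -/
def gs : G h := gw h ^ 2 ^ (n - 1)

theorem gx_pow : gx h ^ p = 1 := by rw [gx, ← map_pow, x_pow, map_one]

theorem gy_pow : gy h ^ p = 1 := by rw [gy, ← map_pow, y_pow, map_one]

theorem gz_pow : gz h ^ p = 1 := by rw [gz, ← map_pow, z_pow, map_one]

theorem gw_pow : gw h ^ 2 ^ n = 1 := by
  rw [gw, ← map_pow, ← ofAdd_nsmul]
  simp

theorem gs_mul_gs : gs h * gs h = 1 := by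
  rw [gs, ← pow_add, ← mul_two, ← h.two_pow_eq', gw_pow]

theorem gx_ne_one : gx h ≠ 1 := by
  have := h.fact_prime
  intro hcon
  exact x_ne_one (SemidirectProduct.inl_injective (hcon.trans (map_one _).symm))

theorem gx_mul_gy : gx h * gy h = gy h * gx h := by
  rw [gx, gy, ← map_mul, x_mul_y, map_mul]

theorem gx_mul_gz : gx h * gz h = gz h * gx h := by
  rw [gx, gz, ← map_mul, x_mul_z, map_mul]

theorem gy_mul_gz : gy h * gz h = gz h * gy h * gx h := by
  rw [gx, gy, gz, ← map_mul, y_mul_z, map_mul, map_mul]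

theorem inl_mul_gw (g : ExtraSpecial p) :
    (SemidirectProduct.inl g : G h) * gw h = gw h * SemidirectProduct.inl (theta h g) := by
  rw [← conj_w]
  group

theorem gx_mul_gw : gx h * gw h = gw h * gx h ^ (r ^ t) := by
  rw [gx, inl_mul_gw, theta_apply, thetaHom_x, map_zpow]

theorem gy_mul_gw : gy h * gw h = gw h * gz h ^ k := by
  rw [gy, inl_mul_gw, theta_apply, thetaHom_y, map_zpow, gz]

theorem gz_mul_gw : gz h * gw h = gw h * gy h ^ q := by
  rw [gz, inl_mul_gw, theta_apply, thetaHom_z, map_zpow, gy]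

theorem inl_mul_gw_pow (m : ℕ) (g : ExtraSpecial p) :
    (SemidirectProduct.inl g : G h) * gw h ^ m =
      gw h ^ m * SemidirectProduct.inl ((theta h ^ m) g) := by
  induction m generalizing g with
  | zero => simp
  | succ m ih =>
    rw [pow_succ', ← mul_assoc, inl_mul_gw, mul_assoc, ih, ← mul_assoc]
    congr 2

theorem gx_mul_gs : gx h * gs h = gs h * gx h := by
  rw [gx, gs, inl_mul_gw_pow, (theta_pow_apply_inv h).1]

theorem gy_mul_gs : gy h * gs h = gs h * (gy h)⁻¹ := by
  rw [gy, gs, inl_mul_gw_pow, (theta_pow_apply_inv h).2.1, map_inv]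

theorem gz_mul_gs : gz h * gs h = gs h * (gz h)⁻¹ := by
  rw [gz, gs, inl_mul_gw_pow, (theta_pow_apply_inv h).2.2, map_inv]

instance finite_G : Finite (G h) := by
  have := h.fact_prime
  exact Finite.of_equiv _ (SemidirectProduct.equivProd (φ := action h)).symm

theorem exists_pow_form_G (g : G h) :
    ∃ (d : ZMod (2 ^ n)) (a b c : ZMod p),
      g = gw h ^ d.val * (gz h ^ c.val * gy h ^ b.val * gx h ^ a.val) := by
  have := h.fact_prime
  have h1 : g.right = Multiplicative.ofAdd (1 : ZMod (2 ^ n)) ^ (Multiplicative.toAdd g.right).val := by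
    rw [← ofAdd_nsmul]
    simp
  have h2 : g = SemidirectProduct.inl g.left * gw h ^ (Multiplicative.toAdd g.right).val := by
    conv_lhs => rw [← SemidirectProduct.inl_left_mul_inr_right g, h1, map_pow]
    rfl
  rw [inl_mul_gw_pow] at h2
  obtain ⟨a, b, c, h3⟩ := exists_pow_form
    ((theta h ^ (Multiplicative.toAdd g.right).val) g.left)
  refine ⟨Multiplicative.toAdd g.right, a, b, c, ?_⟩
  rw [h3] at h2
  refine h2.trans ?_
  simp only [gx, gy, gz, map_mul, map_pow]

/-- A submonoid, so that invariance of a subspace need not be checked under inverses of generators.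
-/
theorem submonoid_closure_generators :
    Submonoid.closure ({gx h, gy h, gz h, gw h} : Set (G h)) = ⊤ := by
  refine top_unique fun g _ => ?_
  obtain ⟨d, a, b, c, rfl⟩ := exists_pow_form_G h g
  have hm : ∀ g ∈ ({gx h, gy h, gz h, gw h} : Set (G h)), ∀ m : ℕ,
      g ^ m ∈ Submonoid.closure ({gx h, gy h, gz h, gw h} : Set (G h)) :=
    fun g hg m => pow_mem (Submonoid.subset_closure hg) m
  exact mul_mem (hm _ (by simp) _) (mul_mem (mul_mem (hm _ (by simp) _) (hm _ (by simp) _))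
    (hm _ (by simp) _))

theorem P_eq_closure : P h = Subgroup.closure {gx h, gy h, gz h} := by
  refine le_antisymm ?_ ?_
  · rintro _ ⟨g, rfl⟩
    obtain ⟨a, b, c, rfl⟩ := exists_zpow_form g
    have hm : ∀ g ∈ ({gx h, gy h, gz h} : Set (G h)), ∀ m : ℤ,
        g ^ m ∈ Subgroup.closure ({gx h, gy h, gz h} : Set (G h)) :=
      fun g hg m => zpow_mem (Subgroup.subset_closure hg) m
    rw [map_mul, map_mul, map_zpow, map_zpow, map_zpow]
    exact mul_mem (mul_mem (hm _ (by simp [gz]) _) (hm _ (by simp [gy]) _))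
      (hm _ (by simp [gx]) _)
  · rw [Subgroup.closure_le]
    rintro _ (rfl | rfl | rfl)
    exacts [⟨_, rfl⟩, ⟨_, rfl⟩, ⟨_, rfl⟩]

theorem gx_mem_P : gx h ∈ P h := ⟨_, rfl⟩

theorem gy_mem_P : gy h ∈ P h := ⟨_, rfl⟩

theorem gz_mem_P : gz h ∈ P h := ⟨_, rfl⟩

theorem gy_mem_Q : gy h ∈ Q h := Subgroup.subset_closure (by simp)

theorem gs_mem_Q : gs h ∈ Q h := Subgroup.subset_closure (by simp [gs])

theorem exists_coset_P (g : G h) : ∃ i : Fin (2 ^ n), (gw h ^ (i : ℕ))⁻¹ * g ∈ P h := by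
  obtain ⟨d, a, b, c, rfl⟩ := exists_pow_form_G h g
  refine ⟨⟨d.val, ZMod.val_lt d⟩, ?_⟩
  rw [inv_mul_cancel_left]
  exact mul_mem (mul_mem (pow_mem (gz_mem_P h) _) (pow_mem (gy_mem_P h) _))
    (pow_mem (gx_mem_P h) _)

theorem exists_coset_Q (g : G h) :
    ∃ i : Fin (2 ^ (n - 1)) × ZMod p,
      (gw h ^ (i.1 : ℕ) * gz h ^ i.2.val)⁻¹ * g ∈ Q h := by
  have := h.fact_prime
  obtain ⟨d, a, b, c, rfl⟩ := exists_pow_form_G h g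
  have hq : gy h ^ b.val * gx h ^ a.val ∈ Q h :=
    mul_mem (pow_mem (gy_mem_Q h) _) (pow_mem (gx_mem_Q h) _)
  by_cases hd : d.val < 2 ^ (n - 1)
  · refine ⟨(⟨d.val, hd⟩, c), ?_⟩
    convert hq using 1
    simp only [mul_assoc, mul_inv_rev, inv_mul_cancel_left]
  · have h1 : d.val < 2 ^ (n - 1) * 2 := h.two_pow_eq' ▸ ZMod.val_lt d
    push Not at hd
    -- Split off s from w^d; moving it right past z^c into `Q` inverts z^c, hence the index `-c`.
    refine ⟨(⟨d.val - 2 ^ (n - 1), by omega⟩, -c), ?_⟩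
    have h2 : gw h ^ d.val = gw h ^ (d.val - 2 ^ (n - 1)) * gs h := by
      rw [gs, ← pow_add, Nat.sub_add_cancel hd]
    have h3 : gz h ^ (-c).val = (gz h ^ c.val)⁻¹ := by
      rw [← zpow_natCast, ← zpow_natCast, ← zpow_neg]
      exact zpow_congr (gz_pow h) (by simp)
    have h4 : gz h ^ c.val * gs h = gs h * (gz h ^ c.val)⁻¹ := by
      have h5 : SemiconjBy (gs h) (gz h)⁻¹ (gz h) := (gz_mul_gs h).symm
      rw [← inv_pow]
      exact (h5.pow_right c.val).eq.symm
    have h6 : gs h * gz h ^ c.val = (gz h ^ c.val)⁻¹ * gs h := by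
      rw [eq_inv_mul_iff_mul_eq, ← mul_assoc, h4, inv_mul_cancel_right]
    convert mul_mem (gs_mem_Q h) hq using 1
    rw [h2, h3]
    simp only [mul_inv_rev, inv_inv, mul_assoc, inv_mul_cancel_left]
    rw [← mul_assoc (gs h) (gz h ^ c.val), h6]
    simp only [mul_assoc, mul_inv_cancel_left]

end Relations

end GpTwo

/-! ### Linear characters of G. -/

theorem eq_one_of_sq_of_odd_pow {M : Type*} [Monoid M] {a : M} {m : ℕ} (hm : Odd m)
    (h2 : a ^ 2 = 1) (h : a ^ m = 1) : a = 1 := by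
  have := pow_gcd_eq_one.2 ⟨h2, h⟩
  rwa [(Nat.coprime_two_left.2 hm).gcd_eq_one, pow_one] at this

theorem linRep_apply {G : Type} [Group G] (φ : G →* ℂˣ) (g : G) (c : ℂ) :
    linRep φ g c = φ g * c := rfl

theorem linRep_isIrreducible {G : Type} [Group G] (φ : G →* ℂˣ) : (linRep φ).IsIrreducible :=
  (linRep φ).isIrreducible_of_invariant fun W _ => eq_bot_or_eq_top W

theorem linRep_character {G : Type} [Group G] (φ : G →* ℂˣ) (g : G) :
    (linRep φ).character g = φ g := by
  have : linRep φ g = (φ g : ℂ) • LinearMap.id := by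
    ext
    simp [linRep_apply]
  rw [Representation.character, this, map_smul, LinearMap.trace_id]
  simp

theorem exists_linear_of_finrank_eq_one {G : Type} [Group G] {V : Type*} [AddCommGroup V]
    [Module ℂ V] [FiniteDimensional ℂ V] (ρ : Representation ℂ G V)
    (hV : Module.finrank ℂ V = 1) : ∃ l : G →* ℂˣ, ρ.character = fun g => (l g : ℂ) := by
  obtain ⟨v, hv, hspan⟩ := finrank_eq_one_iff'.1 hV
  obtain ⟨φ, hφ⟩ := exists_hom_of_eigenvector ρ Set.univ v hv fun g _ => by
    obtain ⟨c, hc⟩ := hspan (ρ g v)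
    exact ⟨c, hc.symm⟩
  refine ⟨φ.comp ((Subgroup.inclusion (Subgroup.closure_univ (G := G)).ge).comp
    Subgroup.topEquiv.symm.toMonoidHom), funext fun g => ?_⟩
  set c : ℂ := (φ.comp ((Subgroup.inclusion (Subgroup.closure_univ (G := G)).ge).comp
    Subgroup.topEquiv.symm.toMonoidHom) g : ℂ)
  have h1 : ρ g v = c • v :=
    hφ.2 ⟨g, (Subgroup.closure_univ (G := G)).ge (Subgroup.mem_top g)⟩
  have h2 : ρ g = c • LinearMap.id := by
    ext w
    obtain ⟨d, rfl⟩ := hspan w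
    rw [map_smul, h1, LinearMap.smul_apply, LinearMap.id_apply, smul_comm]
  rw [Representation.character, h2, map_smul, LinearMap.trace_id, hV]
  simp

namespace GpTwo

variable {p n t : ℕ} {r k q : ℤ} (h : Admissible p n t r k q)

theorem Admissible.odd_prime (h : Admissible p n t r k q) : Odd p :=
  h.prime.odd_of_ne_two h.two_lt.ne'

/-- The relation yz = zyx makes x a commutator. -/
theorem linear_gx (l : G h →* ℂˣ) : l (gx h) = 1 := by
  have := congrArg l (gy_mul_gz h)
  rw [map_mul, map_mul, map_mul, mul_comm (l (gz h)), left_eq_mul] at this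
  exact this

/-- Since s inverts y, the value at y has square 1; its p-th power is also 1, and p is odd. -/
theorem linear_gy (l : G h →* ℂˣ) : l (gy h) = 1 := by
  have h1 := congrArg l (gy_mul_gs h)
  rw [map_mul, map_mul, map_inv, mul_comm (l (gs h)), mul_left_inj, eq_inv_iff_mul_eq_one,
    ← pow_two] at h1
  exact eq_one_of_sq_of_odd_pow h.odd_prime h1 (by rw [← map_pow, gy_pow, map_one])

theorem linear_gz (l : G h →* ℂˣ) : l (gz h) = 1 := by
  have h1 := congrArg l (gz_mul_gs h)
  rw [map_mul, map_mul, map_inv, mul_comm (l (gs h)), mul_left_inj, eq_inv_iff_mul_eq_one,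
    ← pow_two] at h1
  exact eq_one_of_sq_of_odd_pow h.odd_prime h1 (by rw [← map_pow, gz_pow, map_one])

theorem linear_trivial_on_P (l : G h →* ℂˣ) : ∀ g ∈ P h, l g = 1 := by
  have : P h ≤ l.ker := by
    rw [P_eq_closure, Subgroup.closure_le]
    rintro _ (rfl | rfl | rfl)
    exacts [linear_gx h l, linear_gy h l, linear_gz h l]
  exact fun g hg => this hg

theorem linear_ext {l l' : G h →* ℂˣ} (hl : l (gw h) = l' (gw h)) : l = l' := by
  refine MonoidHom.eq_of_eqOn_denseM (submonoid_closure_generators h) ?_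
  rintro _ (rfl | rfl | rfl | rfl)
  · rw [linear_gx, linear_gx]
  · rw [linear_gy, linear_gy]
  · rw [linear_gz, linear_gz]
  · exact hl

theorem exists_linear {ζ : ℂˣ} (hζ : ζ ^ 2 ^ n = 1) : ∃ l : G h →* ℂˣ, l (gw h) = ζ := by
  let f : Cyc n →* ℂˣ := AddMonoidHom.toMultiplicativeLeft
    (ZMod.lift (2 ^ n) (A := Additive ℂˣ)
      ⟨zmultiplesHom (Additive ℂˣ) (Additive.ofMul ζ), by
        rw [zmultiplesHom_apply, natCast_zsmul, ← ofMul_pow, hζ, ofMul_one]⟩)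
  refine ⟨f.comp SemidirectProduct.rightHom, ?_⟩
  have h1 : (1 : ZMod (2 ^ n)) = ((1 : ℤ) : ZMod (2 ^ n)) := by simp
  rw [MonoidHom.comp_apply, gw, SemidirectProduct.rightHom_inr]
  change Additive.toMul (ZMod.lift (2 ^ n) _ (1 : ZMod (2 ^ n))) = ζ
  rw [h1, ZMod.lift_coe]
  simp

theorem exists_linear_enumeration {ζ : ℂˣ} (hζ : IsPrimitiveRoot ζ (2 ^ n)) :
    ∃ l : Fin (2 ^ n) → (G h →* ℂˣ), Function.Bijective l ∧
      ∀ i : Fin (2 ^ n), l i (gx h) = 1 ∧ l i (gy h) = 1 ∧ l i (gz h) = 1 ∧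
        l i (gw h) = ζ ^ (i : ℕ) := by
  choose l hl using fun i : Fin (2 ^ n) => exists_linear h (ζ := ζ ^ (i : ℕ))
    (by rw [pow_right_comm, hζ.pow_eq_one, one_pow])
  refine ⟨l, ⟨fun i j hij => ?_, fun l' => ?_⟩,
    fun i => ⟨linear_gx h _, linear_gy h _, linear_gz h _, hl i⟩⟩
  · have := hl i
    rw [hij, hl j] at this
    exact Fin.ext (hζ.pow_inj i.2 j.2 this.symm)
  · have h1 : (l' (gw h)) ^ 2 ^ n = 1 := by rw [← map_pow, gw_pow, map_one]
    obtain ⟨i, hi, h2⟩ := (IsPrimitiveRoot.coe_units_iff.2 hζ).eq_pow_of_pow_eq_one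
      (ξ := (l' (gw h) : ℂ)) (by rw [← Units.val_pow_eq_pow_val, h1, Units.val_one])
    replace h2 : ζ ^ i = l' (gw h) := Units.ext (by rw [Units.val_pow_eq_pow_val, h2])
    exact ⟨⟨i, hi⟩, linear_ext h ((hl _).trans h2)⟩

theorem exists_units_primitiveRoot (m : ℕ) [NeZero m] : ∃ ζ : ℂˣ, IsPrimitiveRoot ζ m :=
  ⟨_, (Complex.isPrimitiveRoot_exp m (NeZero.ne m)).isUnit_unit (NeZero.ne m)⟩

theorem card_linear : Nat.card (G h →* ℂˣ) = 2 ^ n := by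
  obtain ⟨ζ, hζ⟩ := exists_units_primitiveRoot (2 ^ n)
  obtain ⟨l, hl, -⟩ := exists_linear_enumeration h hζ
  rw [← Nat.card_congr (Equiv.ofBijective l hl), Nat.card_fin]

end GpTwo

theorem degree_one_irrChar_eq {G : Type} [Group G] :
    { χ ∈ IrrChar G | χ 1 = 1 } = Set.range (fun (l : G →* ℂˣ) (g : G) => (l g : ℂ)) := by
  ext χ
  constructor
  · rintro ⟨⟨V, _, _, _, ρ, -, rfl⟩, h1⟩
    rw [Representation.char_one] at h1
    obtain ⟨l, hl⟩ := exists_linear_of_finrank_eq_one ρ (by exact_mod_cast h1)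
    exact ⟨l, hl.symm⟩
  · rintro ⟨l, rfl⟩
    exact ⟨⟨ℂ, _, _, inferInstance, linRep l, linRep_isIrreducible l,
      funext (linRep_character l)⟩, by simp⟩

/-! ### Carrying eigenvalues along generators and relations. -/

open Module

theorem isEigen_of_generators {G : Type} [Group G] {V : Type*} [AddCommGroup V] [Module ℂ V]
    (ρ : Representation ℂ G V) (H : Subgroup G) (S : Set G) (hH : H = Subgroup.closure S)
    (hSH : ∀ g ∈ S, g ∈ H) (φ : H →* ℂˣ) (v : V) (hv : v ≠ 0)
    (hS : ∀ g (hg : g ∈ S), ρ g v = (φ ⟨g, hSH g hg⟩ : ℂ) • v) : IsEigen ρ H φ v := by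
  subst hH
  exact isEigen_closure_of_generators ρ S φ v hv hS

theorem hom_ext_of_generators {G M : Type*} [Group G] [Group M] (H : Subgroup G) (S : Set G)
    (hH : H = Subgroup.closure S) (hSH : ∀ g ∈ S, g ∈ H) {φ ψ : H →* M}
    (hS : ∀ g (hg : g ∈ S), φ ⟨g, hSH g hg⟩ = ψ ⟨g, hSH g hg⟩) : φ = ψ := by
  subst hH
  refine MonoidHom.eq_of_eqOn_dense (s := (Subtype.val ⁻¹' S : Set (Subgroup.closure S)))
    (Subgroup.closure_closure_coe_preimage) ?_
  rintro ⟨g, hg⟩ hgS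
  exact hS g hgS

section

variable {G : Type} [Group G] {V : Type*} [AddCommGroup V] [Module ℂ V]
  (ρ : Representation ℂ G V)

theorem rho_pow_eigen {g : G} {μ : ℂ} {v : V} (hv : ρ g v = μ • v) (m : ℕ) :
    ρ (g ^ m) v = μ ^ m • v := by
  induction m with
  | zero => simp
  | succ m ih =>
    rw [pow_succ, map_mul, Module.End.mul_apply, hv, map_smul, ih, smul_smul, pow_succ, mul_comm]

theorem rho_inv_eigen {g : G} {μ : ℂˣ} {v : V} (hv : ρ g v = (μ : ℂ) • v) :
    ρ g⁻¹ v = ((μ⁻¹ : ℂˣ) : ℂ) • v := by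
  rw [ρ.inv_apply_eq_iff, map_smul, hv, smul_smul, ← Units.val_mul, inv_mul_cancel,
    Units.val_one, one_smul]

theorem rho_zpow_eigen {g : G} {μ : ℂˣ} {v : V} (hv : ρ g v = (μ : ℂ) • v) (m : ℤ) :
    ρ (g ^ m) v = ((μ ^ m : ℂˣ) : ℂ) • v := by
  cases m with
  | ofNat m =>
    have := rho_pow_eigen ρ hv m
    simpa using this
  | negSucc m =>
    rw [zpow_negSucc, zpow_negSucc]
    refine rho_inv_eigen ρ ?_
    rw [Units.val_pow_eq_pow_val]
    exact rho_pow_eigen ρ hv _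

theorem rho_zpow_fixed {g : G} {v : V} (hv : ρ g v = v) (m : ℤ) : ρ (g ^ m) v = v := by
  have := rho_zpow_eigen ρ (μ := 1) (v := v) (g := g) (by simpa using hv) m
  simpa using this

theorem rho_comm_apply {a b c d : G} (hab : a * b = c * d) (v : V) :
    ρ a (ρ b v) = ρ c (ρ d v) := by
  rw [← Module.End.mul_apply, ← Module.End.mul_apply, ← map_mul, ← map_mul, hab]

theorem rho_ne_zero (g : G) {v : V} (hv : v ≠ 0) : ρ g v ≠ 0 := by
  intro hcon
  apply hv
  rw [← ρ.inv_self_apply g v, hcon, map_zero]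

theorem invariant_of_generators {S : Set G} (hS : Submonoid.closure S = ⊤) (W : Submodule ℂ V)
    (hW : ∀ g ∈ S, ∀ v ∈ W, ρ g v ∈ W) : ∀ g, ∀ v ∈ W, ρ g v ∈ W := by
  intro g
  have hg : g ∈ Submonoid.closure S := hS ▸ Submonoid.mem_top g
  induction hg using Submonoid.closure_induction with
  | mem g hg => exact hW g hg
  | one => intro v hv; simpa using hv
  | mul a b _ _ ha hb =>
    intro v hv
    rw [map_mul]
    exact ha _ (hb v hv)

end

theorem Nat.card_subtype_ne {X : Type*} [Finite X] (a : X) :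
    Nat.card {b : X // b ≠ a} = Nat.card X - 1 := by
  classical
  have := Fintype.ofFinite X
  rw [Nat.card_eq_fintype_card, Nat.card_eq_fintype_card, Fintype.card_subtype_compl,
    Fintype.card_subtype_eq]

/-! ### Characters induced from P. -/

namespace GpTwo

open ExtraSpecial

variable {p n t : ℕ} {r k q : ℤ}

/-- The pairs of values that a linear character of `P` can take at `y` and `z`. -/
abbrev PData (p : ℕ) : Type := rootsOfUnity p ℂ × rootsOfUnity p ℂ

/-- The effect of conjugation by `w` on the values of a linear character of `P`. -/
def twist (k q : ℤ) (a : PData p) : PData p := (a.2 ^ k, a.1 ^ q)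

theorem PData.pow_eq_one (a : PData p) : a ^ p = 1 := by
  ext1 <;> exact Subtype.ext (mem_rootsOfUnity _ _ |>.1 (Subtype.prop _))

theorem twist_iterate_two (a : PData p) : (twist k q)^[2] a = a ^ (k * q) := by
  simp only [Function.iterate_succ, Function.iterate_zero, Function.comp_apply, id, twist]
  ext1
  · rw [Prod.pow_fst, mul_comm, zpow_mul]
  · rw [Prod.pow_snd, zpow_mul]

theorem twist_iterate_two_mul (a : PData p) (m : ℕ) :
    (twist k q)^[2 * m] a = a ^ ((k * q) ^ m) := by
  rw [Function.iterate_mul]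
  induction m with
  | zero => simp
  | succ m ih => rw [Function.iterate_succ_apply', ih, twist_iterate_two, ← zpow_mul, pow_succ]

section

variable (h : Admissible p n t r k q)
include h

theorem twist_iterate_half (a : PData p) : (twist k q)^[2 ^ (n - 1)] a = a⁻¹ := by
  rw [h.two_pow_eq, mul_comm, twist_iterate_two_mul, ← zpow_neg_one]
  refine zpow_congr (PData.pow_eq_one a) ?_
  push_cast
  exact h.kq_pow

theorem twist_iterate_two_pow (a : PData p) : (twist k q)^[2 ^ n] a = a := by
  rw [h.two_pow_eq', mul_two, Function.iterate_add_apply, twist_iterate_half h,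
    twist_iterate_half h, inv_inv]

/-- The period divides 2^n but not 2^(n-1): that iterate is inversion, which fixes no nontrivial
pair as p is odd. -/
theorem twist_minimalPeriod {a : PData p} (ha : a ≠ 1) :
    Function.minimalPeriod (twist k q) a = 2 ^ n := by
  have hn : n - 1 + 1 = n := by have := h.three_le; omega
  rw [← hn]
  refine Function.minimalPeriod_eq_prime_pow (fun hcon => ha ?_) ?_
  · have h1 : a⁻¹ = a := (twist_iterate_half h a).symm.trans hcon
    rw [inv_eq_iff_mul_eq_one, ← pow_two] at h1
    exact eq_one_of_sq_of_odd_pow h.odd_prime h1 (PData.pow_eq_one a)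
  · rw [hn]
    exact twist_iterate_two_pow h a

theorem twist_iterate_injective {a : PData p} (ha : a ≠ 1) :
    Function.Injective fun i : Fin (2 ^ n) => (twist k q)^[(i : ℕ)] a := by
  intro i j hij
  refine Fin.ext (Function.iterate_injOn_Iio_minimalPeriod ?_ ?_ hij)
  · rw [twist_minimalPeriod h ha]; exact i.2
  · rw [twist_minimalPeriod h ha]; exact j.2

theorem twist_iterate_ne_one {a : PData p} (ha : a ≠ 1) (i : Fin (2 ^ n)) :
    (twist k q)^[(i : ℕ)] a ≠ 1 := by
  intro hcon
  apply ha
  rw [← twist_iterate_two_pow h a, ← Nat.sub_add_cancel i.2.le, Function.iterate_add_apply, hcon]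
  exact Function.iterate_fixed (by simp [twist]) _

end

theorem charP_rels (a : PData p) : ∀ s ∈ rels p, FreeGroup.lift
    (fun g : Gen => match g with
      | Gen.x => (1 : ℂˣ)
      | Gen.y => a.1
      | Gen.z => a.2) s = 1 := by
  intro s hs
  simp only [rels, Set.mem_insert_iff, Set.mem_singleton_iff] at hs
  rcases hs with rfl | rfl | rfl | rfl | rfl | rfl
  · simp
  · simpa only [map_pow, FreeGroup.lift_apply_of] using (mem_rootsOfUnity _ _).1 a.1.2
  · simpa only [map_pow, FreeGroup.lift_apply_of] using (mem_rootsOfUnity _ _).1 a.2.2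
  all_goals
    simp only [map_mul, map_inv, FreeGroup.lift_apply_of, mul_inv_eq_one, mul_one, one_mul]
  exact mul_comm _ _

variable (h : Admissible p n t r k q)

theorem exists_charP (a : PData p) : ∃ φ : P h →* ℂˣ,
    φ ⟨gy h, gy_mem_P h⟩ = a.1 ∧ φ ⟨gz h, gz_mem_P h⟩ = a.2 := by
  let e := MonoidHom.ofInjective (f := (SemidirectProduct.inl : ExtraSpecial p →* G h))
    SemidirectProduct.inl_injective
  have hy : e.symm ⟨gy h, gy_mem_P h⟩ = y p := e.symm_apply_eq.2 rfl
  have hz : e.symm ⟨gz h, gz_mem_P h⟩ = z p := e.symm_apply_eq.2 rfl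
  refine ⟨(PresentedGroup.toGroup (charP_rels a)).comp e.symm.toMonoidHom, ?_, ?_⟩
  · exact (congrArg _ hy).trans (PresentedGroup.toGroup.of (charP_rels a))
  · exact (congrArg _ hz).trans (PresentedGroup.toGroup.of (charP_rels a))

theorem generators_mem_P : ∀ g ∈ ({gx h, gy h, gz h} : Set (G h)), g ∈ P h := by
  rintro _ (rfl | rfl | rfl)
  exacts [gx_mem_P h, gy_mem_P h, gz_mem_P h]

theorem charP_gx (φ : P h →* ℂˣ) : φ ⟨gx h, gx_mem_P h⟩ = 1 := by
  have h1 : (⟨gy h, gy_mem_P h⟩ * ⟨gz h, gz_mem_P h⟩ : P h) =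
      ⟨gz h, gz_mem_P h⟩ * ⟨gy h, gy_mem_P h⟩ * ⟨gx h, gx_mem_P h⟩ := Subtype.ext (gy_mul_gz h)
  have := congrArg φ h1
  rw [map_mul, map_mul, map_mul, mul_comm (φ ⟨gz h, _⟩), left_eq_mul] at this
  exact this

/-- The linear character of `P` with given values at `y` and `z`. -/
noncomputable def charP (a : PData p) : P h →* ℂˣ := (exists_charP h a).choose

theorem charP_gy (a : PData p) : charP h a ⟨gy h, gy_mem_P h⟩ = a.1 :=
  (exists_charP h a).choose_spec.1

theorem charP_gz (a : PData p) : charP h a ⟨gz h, gz_mem_P h⟩ = a.2 :=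
  (exists_charP h a).choose_spec.2

theorem charP_surjective : Function.Surjective (charP h) := by
  intro φ
  have hy : φ ⟨gy h, gy_mem_P h⟩ ∈ rootsOfUnity p ℂ := by
    rw [mem_rootsOfUnity, ← map_pow]
    exact (congrArg φ (Subtype.ext (gy_pow h))).trans (map_one φ)
  have hz : φ ⟨gz h, gz_mem_P h⟩ ∈ rootsOfUnity p ℂ := by
    rw [mem_rootsOfUnity, ← map_pow]
    exact (congrArg φ (Subtype.ext (gz_pow h))).trans (map_one φ)
  refine ⟨(⟨_, hy⟩, ⟨_, hz⟩), ?_⟩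
  refine hom_ext_of_generators _ _ (P_eq_closure h) (generators_mem_P h) ?_
  rintro _ (rfl | rfl | rfl)
  · rw [charP_gx, charP_gx]
  · exact charP_gy h _
  · exact charP_gz h _

theorem charP_eq_one_iff (a : PData p) : charP h a = 1 ↔ a = 1 := by
  constructor
  · intro ha
    have hy := charP_gy h a
    have hz := charP_gz h a
    rw [ha] at hy hz
    exact Prod.ext (Subtype.ext hy.symm) (Subtype.ext hz.symm)
  · rintro rfl
    refine hom_ext_of_generators _ _ (P_eq_closure h) (generators_mem_P h) ?_
    rintro _ (rfl | rfl | rfl)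
    · rw [charP_gx, charP_gx]
    · exact charP_gy h _
    · exact charP_gz h _

section

variable {h} {V : Type*} [AddCommGroup V] [Module ℂ V] (ρ : Representation ℂ (G h) V)

/-- A nonzero vector on which `x`, `y`, `z` act by `1` and by a given pair of scalars. -/
def IsPVector (a : PData p) (v : V) : Prop :=
  v ≠ 0 ∧ ρ (gx h) v = v ∧ ρ (gy h) v = ((a.1 : ℂˣ) : ℂ) • v ∧ ρ (gz h) v = ((a.2 : ℂˣ) : ℂ) • v

theorem isPVector_iff (a : PData p) (v : V) :
    IsPVector ρ a v ↔ IsEigen ρ (P h) (charP h a) v := by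
  constructor
  · rintro ⟨hv, hx, hy, hz⟩
    refine isEigen_of_generators ρ _ _ (P_eq_closure h) (generators_mem_P h) _ v hv ?_
    rintro _ (rfl | rfl | rfl)
    · rw [charP_gx, hx, Units.val_one, one_smul]
    · rw [hy, charP_gy]
    · rw [hz, charP_gz]
  · rintro ⟨hv, hg⟩
    refine ⟨hv, ?_, ?_, ?_⟩
    · have := hg ⟨gx h, gx_mem_P h⟩
      rwa [charP_gx, Units.val_one, one_smul] at this
    · have := hg ⟨gy h, gy_mem_P h⟩
      rwa [charP_gy] at this
    · have := hg ⟨gz h, gz_mem_P h⟩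
      rwa [charP_gz] at this

variable {ρ}

/-- Read off from g w = w θ(g), with θ interchanging the roles of y and z. -/
theorem IsPVector.gw {a : PData p} {v : V} (hv : IsPVector ρ a v) :
    IsPVector ρ (twist k q a) (ρ (gw h) v) := by
  obtain ⟨hv, hx, hy, hz⟩ := hv
  refine ⟨rho_ne_zero ρ _ hv, ?_, ?_, ?_⟩
  · rw [rho_comm_apply ρ (gx_mul_gw h), rho_zpow_fixed ρ hx]
  · rw [rho_comm_apply ρ (gy_mul_gw h), rho_zpow_eigen ρ hz, map_smul]
    rfl
  · rw [rho_comm_apply ρ (gz_mul_gw h), rho_zpow_eigen ρ hy, map_smul]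
    rfl

theorem IsPVector.gw_pow {a : PData p} {v : V} (hv : IsPVector ρ a v) (i : ℕ) :
    IsPVector ρ ((twist k q)^[i] a) (ρ (GpTwo.gw h ^ i) v) := by
  induction i with
  | zero => simpa using hv
  | succ i ih =>
    rw [Function.iterate_succ_apply', pow_succ', map_mul]
    exact ih.gw

/-- The pairs of scalars as a family of eigenvalues. -/
def PData.values (a : PData p) (j : Bool) : ℂ := if j then ((a.1 : ℂˣ) : ℂ) else ((a.2 : ℂˣ) : ℂ)

theorem PData.values_injective : Function.Injective (PData.values (p := p)) := by
  intro a b hab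
  have h1 := congrFun hab true
  have h2 := congrFun hab false
  simp only [PData.values, if_true, Bool.false_eq_true, if_false, Units.val_inj] at h1 h2
  exact Prod.ext (Subtype.ext h1) (Subtype.ext h2)

theorem IsPVector.apply {a : PData p} {v : V} (hv : IsPVector ρ a v) (j : Bool) :
    (if j then ρ (gy h) else ρ (gz h)) v = a.values j • v := by
  cases j
  · exact hv.2.2.2
  · exact hv.2.2.1

/-- The 2^n translates by powers of `w` have distinct pairs of eigenvalues, as many as there are
coset representatives of `P`. -/
theorem IsPVector.character_eq [FiniteDimensional ℂ V] (hρ : ρ.IsIrreducible) {a : PData p}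
    (ha : a ≠ 1) {v : V} (hv : IsPVector ρ a v) :
    finrank ℂ V = 2 ^ n ∧ ρ.character = indChar (P h) (charP h a) := by
  have hli := linearIndependent_of_joint_eigenvectors
    (fun j : Bool => if j then ρ (gy h) else ρ (gz h))
    (fun i : Fin (2 ^ n) => ((twist k q)^[(i : ℕ)] a).values)
    (PData.values_injective.comp (twist_iterate_injective h ha)) (fun i => ρ (GpTwo.gw h ^ (i : ℕ)) v)
    (fun i => (hv.gw_pow i).1) (fun i => (hv.gw_pow i).apply)
  have := character_eq_indChar ρ hρ (P h) (charP h a) v ((isPVector_iff ρ a v).1 hv)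
    (fun i : Fin (2 ^ n) => GpTwo.gw h ^ (i : ℕ)) (exists_coset_P h) hli.fintype_card_le_finrank
  rwa [Fintype.card_fin] at this

theorem IsPVector.exists_iterate_eq [FiniteDimensional ℂ V] (hρ : ρ.IsIrreducible) {a b : PData p}
    (ha : a ≠ 1) {v v' : V} (hv : IsPVector ρ a v) (hv' : IsPVector ρ b v') :
    ∃ i : Fin (2 ^ n), (twist k q)^[(i : ℕ)] a = b := by
  obtain ⟨i, hi, -⟩ := eq_smul_of_joint_eigenvector
    (fun j : Bool => if j then ρ (gy h) else ρ (gz h))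
    (fun i : Fin (2 ^ n) => ((twist k q)^[(i : ℕ)] a).values)
    (PData.values_injective.comp (twist_iterate_injective h ha)) (fun i => ρ (GpTwo.gw h ^ (i : ℕ)) v)
    (fun i => (hv.gw_pow i).1) (fun i => (hv.gw_pow i).apply)
    (by rw [Fintype.card_fin, (hv.character_eq hρ ha).1]) b.values v' hv'.1 hv'.apply
  exact ⟨i, PData.values_injective hi⟩

end

theorem exists_irreducible_isPVector (a : PData p) :
    ∃ (W : Type) (_ : AddCommGroup W) (_ : Module ℂ W) (_ : FiniteDimensional ℂ W)
      (σ : Representation ℂ (G h) W) (w : W), σ.IsIrreducible ∧ IsPVector σ a w := by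
  obtain ⟨W, _, _, _, σ, w, hσ, hw⟩ := exists_irreducible_isEigen (P h) (charP h a)
  exact ⟨W, _, _, inferInstance, σ, w, hσ, (isPVector_iff σ a w).2 hw⟩

/-- An isomorphism puts an eigenvector for `b` into the space of `a`, where only the orbit of `a`
occurs. Conversely a translate by a power of `w` realises `b` in that same space. -/
theorem indChar_charP_eq_iff {a b : PData p} (ha : a ≠ 1) (hb : b ≠ 1) :
    indChar (P h) (charP h b) = indChar (P h) (charP h a) ↔
      ∃ i : Fin (2 ^ n), (twist k q)^[(i : ℕ)] a = b := by
  obtain ⟨V, _, _, _, ρ, v, hρ, hv⟩ := exists_irreducible_isPVector h a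
  have hchar := (hv.character_eq hρ ha).2
  constructor
  · intro hab
    obtain ⟨W, _, _, _, σ, w, hσ, hw⟩ := exists_irreducible_isPVector h b
    have hchar' := (hw.character_eq hσ hb).2
    obtain ⟨e⟩ := nonempty_equiv_of_character_eq ρ σ hρ hσ (by rw [hchar, hchar', hab])
    exact hv.exists_iterate_eq hρ ha
      ((isPVector_iff ρ b _).2 (isEigen_of_equiv e ((isPVector_iff σ b w).1 hw)))
  · rintro ⟨i, rfl⟩
    rw [← hchar, ((hv.gw_pow i).character_eq hρ hb).2]

theorem familyP_eq_range :
    familyP h = Set.range fun a : {a : PData p // a ≠ 1} => indChar (P h) (charP h a) := by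
  ext χ
  constructor
  · rintro ⟨φ, hφ, rfl⟩
    obtain ⟨a, rfl⟩ := charP_surjective h φ
    exact ⟨⟨a, fun ha => hφ ((charP_eq_one_iff h a).2 ha)⟩, rfl⟩
  · rintro ⟨a, rfl⟩
    exact ⟨charP h a, fun ha => a.2 ((charP_eq_one_iff h _).1 ha), rfl⟩

theorem familyP_subset_irrChar : familyP h ⊆ IrrChar (G h) := by
  rw [familyP_eq_range]
  rintro _ ⟨a, rfl⟩
  obtain ⟨V, _, _, _, ρ, v, hρ, hv⟩ := exists_irreducible_isPVector h a
  exact ⟨V, _, _, inferInstance, ρ, hρ, (hv.character_eq hρ a.2).2⟩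

theorem familyP_degree : ∀ χ ∈ familyP h, χ 1 = 2 ^ n := by
  rw [familyP_eq_range]
  rintro _ ⟨a, rfl⟩
  obtain ⟨V, _, _, _, ρ, v, hρ, hv⟩ := exists_irreducible_isPVector h a
  dsimp only
  rw [← (hv.character_eq hρ a.2).2, Representation.char_one, (hv.character_eq hρ a.2).1]
  simp

theorem familyP_finite : (familyP h).Finite := by
  have := h.fact_prime
  rw [familyP_eq_range]
  exact Set.finite_range _

theorem familyP_card : p ^ 2 - 1 = 2 ^ n * (familyP h).ncard := by
  have := h.fact_prime
  have hcard : Nat.card {a : PData p // a ≠ 1} = p ^ 2 - 1 := by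
    rw [Nat.card_subtype_ne, Nat.card_prod, Complex.card_rootsOfUnity, pow_two]
  rw [← hcard, familyP_eq_range]
  refine card_eq_mul_ncard_range _ _ fun a => ?_
  refine ⟨fun i => ⟨_, twist_iterate_ne_one h a.2 i⟩, fun i j hij => ?_, fun b => ?_⟩
  · exact twist_iterate_injective h a.2 (congrArg Subtype.val hij)
  · rw [indChar_charP_eq_iff h a.2 b.2]
    simp only [Subtype.ext_iff]

end GpTwo

/-! ### Characters induced from Q. -/

namespace GpTwo

open ExtraSpecial

variable {p n t : ℕ} {r k q : ℤ}

/-- The effect of conjugation by `w` on the value at `x` of a character. -/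
def turn (r : ℤ) (t : ℕ) (ω : rootsOfUnity p ℂ) : rootsOfUnity p ℂ := ω ^ (r ^ t)

theorem turn_iterate (ω : rootsOfUnity p ℂ) (m : ℕ) :
    (turn r t)^[m] ω = ω ^ ((r ^ t) ^ m) := by
  induction m with
  | zero => simp
  | succ m ih => rw [Function.iterate_succ_apply', ih, turn, ← zpow_mul, pow_succ]

theorem rootsOfUnity_pow_eq_one {m : ℕ} (ω : rootsOfUnity m ℂ) : ω ^ m = 1 :=
  Subtype.ext ((mem_rootsOfUnity _ _).1 ω.2)

theorem isPrimitiveRoot_of_ne_one [Fact p.Prime] {ω : rootsOfUnity p ℂ} (hω : ω ≠ 1) :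
    IsPrimitiveRoot ((ω : ℂˣ) : ℂ) p := by
  have h1 : IsPrimitiveRoot ω p :=
    IsPrimitiveRoot.iff_orderOf.2 (orderOf_eq_prime (rootsOfUnity_pow_eq_one ω) hω)
  exact IsPrimitiveRoot.coe_units_iff.2 (IsPrimitiveRoot.coe_submonoidClass_iff.2 h1)

section

variable (h : Admissible p n t r k q)
include h

theorem turn_iterate_half (ω : rootsOfUnity p ℂ) : (turn r t)^[2 ^ (n - 2)] ω = ω⁻¹ := by
  rw [turn_iterate, ← zpow_neg_one]
  refine zpow_congr (rootsOfUnity_pow_eq_one ω) ?_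
  push_cast
  exact h.u_pow

theorem turn_iterate_two_pow (ω : rootsOfUnity p ℂ) : (turn r t)^[2 ^ (n - 1)] ω = ω := by
  rw [h.two_pow_eq, mul_two, Function.iterate_add_apply, turn_iterate_half h,
    turn_iterate_half h, inv_inv]

/-- Half a turn is inversion, which fixes no nontrivial p-th root of unity. -/
theorem turn_minimalPeriod {ω : rootsOfUnity p ℂ} (hω : ω ≠ 1) :
    Function.minimalPeriod (turn r t) ω = 2 ^ (n - 1) := by
  have hn : n - 2 + 1 = n - 1 := by have := h.three_le; omega
  rw [← hn]
  refine Function.minimalPeriod_eq_prime_pow (fun hcon => hω ?_) ?_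
  · have h1 : ω⁻¹ = ω := (turn_iterate_half h ω).symm.trans hcon
    rw [inv_eq_iff_mul_eq_one, ← pow_two] at h1
    exact eq_one_of_sq_of_odd_pow h.odd_prime h1 (rootsOfUnity_pow_eq_one ω)
  · rw [hn]
    exact turn_iterate_two_pow h ω

theorem turn_iterate_injective {ω : rootsOfUnity p ℂ} (hω : ω ≠ 1) :
    Function.Injective fun i : Fin (2 ^ (n - 1)) => (turn r t)^[(i : ℕ)] ω := by
  intro i j hij
  refine Fin.ext (Function.iterate_injOn_Iio_minimalPeriod ?_ ?_ hij)
  · rw [turn_minimalPeriod h hω]; exact i.2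
  · rw [turn_minimalPeriod h hω]; exact j.2

theorem turn_ne_one {ω : rootsOfUnity p ℂ} (hω : ω ≠ 1) : turn r t ω ≠ 1 := by
  intro hcon
  apply hω
  rw [← turn_iterate_two_pow h ω, ← Nat.sub_add_cancel (Nat.one_le_two_pow (n := n - 1)),
    Function.iterate_succ_apply, hcon]
  exact Function.iterate_fixed (by simp [turn]) _

theorem turn_iterate_ne_one {ω : rootsOfUnity p ℂ} (hω : ω ≠ 1) (i : ℕ) :
    (turn r t)^[i] ω ≠ 1 := by
  induction i with
  | zero => exact hω
  | succ i ih => rw [Function.iterate_succ_apply']; exact turn_ne_one h ih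

end

section Relations

variable (h : Admissible p n t r k q)

theorem gy_mul_gz_pow (c : ℕ) : gy h * gz h ^ c = gz h ^ c * (gy h * gx h ^ c) := by
  have := y_zpow_mul_z_zpow (p := p) 1 c
  rw [zpow_one, one_mul, zpow_natCast, zpow_natCast] at this
  rw [gx, gy, gz, ← map_pow, ← map_mul, this, map_mul, map_mul, map_pow, map_pow, mul_assoc]

theorem gz_mul_gy_pow (b : ℕ) : gz h * gy h ^ b = gy h ^ b * (gz h * (gx h ^ b)⁻¹) := by
  have h1 := y_zpow_mul_z (p := p) b
  rw [zpow_natCast, zpow_natCast] at h1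
  have h2 : gy h ^ b * gz h = gz h * gy h ^ b * gx h ^ b := by
    rw [gx, gy, gz, ← map_pow, ← map_mul, h1, map_mul, map_mul, map_pow, map_pow]
  rw [← mul_assoc, h2, mul_inv_cancel_right]

theorem gs_mul_gy_pow (b : ℕ) : gs h * gy h ^ b = (gy h ^ b)⁻¹ * gs h := by
  have h1 : SemiconjBy (gs h) (gy h)⁻¹ (gy h) := (gy_mul_gs h).symm
  have h2 := (h1.pow_right b).inv_right
  rwa [inv_pow, inv_inv] at h2

theorem gs_mul_gw : gs h * gw h = gw h * gs h := ((Commute.refl (gw h)).pow_left _).eq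

theorem gx_mul_gz_pow (c : ℕ) : gx h * gz h ^ c = gz h ^ c * gx h :=
  ((show Commute (gx h) (gz h) from gx_mul_gz h).pow_right c).eq

theorem gx_mul_gy_pow (c : ℕ) : gx h * gy h ^ c = gy h ^ c * gx h :=
  ((show Commute (gx h) (gy h) from gx_mul_gy h).pow_right c).eq

end Relations

variable {h : Admissible p n t r k q}

section

variable {V : Type*} [AddCommGroup V] [Module ℂ V] {ρ : Representation ℂ (G h) V}

/-- A nonzero vector on which `x`, `y`, `w ^ (2 ^ (n - 1))` act by scalars `ω`, `1`, `e`. -/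
def IsQVector (ρ : Representation ℂ (G h) V) (ω : rootsOfUnity p ℂ) (e : rootsOfUnity 2 ℂ)
    (v : V) : Prop :=
  v ≠ 0 ∧ ρ (gx h) v = ((ω : ℂˣ) : ℂ) • v ∧ ρ (gy h) v = v ∧ ρ (gs h) v = ((e : ℂˣ) : ℂ) • v

/-- Applying `w` turns the y-fixed vector into a z-fixed one with x-eigenvalue ω^u. Summing its
translates by all powers of y restores invariance under y. -/
theorem IsQVector.exists_turn {ω : rootsOfUnity p ℂ} {e : rootsOfUnity 2 ℂ} (hω : ω ≠ 1) {v : V}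
    (hv : IsQVector ρ ω e v) : ∃ v', IsQVector ρ (turn r t ω) e v' := by
  have := h.fact_prime
  obtain ⟨hv, hx, hy, hs⟩ := hv
  set v₁ := ρ (gw h) v with hv₁
  have hne : v₁ ≠ 0 := rho_ne_zero ρ _ hv
  have hx₁ : ρ (gx h) v₁ = ((turn r t ω : ℂˣ) : ℂ) • v₁ := by
    rw [hv₁, rho_comm_apply ρ (gx_mul_gw h), rho_zpow_eigen ρ hx, map_smul]
    rfl
  have hz₁ : ρ (gz h) v₁ = v₁ := by
    rw [hv₁, rho_comm_apply ρ (gz_mul_gw h), rho_zpow_fixed ρ hy]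
  have hs₁ : ρ (gs h) v₁ = ((e : ℂˣ) : ℂ) • v₁ := by
    rw [hv₁, rho_comm_apply ρ (gs_mul_gw h), hs, map_smul]
  have hprim := isPrimitiveRoot_of_ne_one (turn_ne_one h hω)
  have hz : ∀ b : ℕ, ρ (gz h) (ρ (gy h ^ b) v₁) =
      (((turn r t ω : ℂˣ) ^ b)⁻¹ : ℂˣ) • ρ (gy h ^ b) v₁ := by
    intro b
    rw [rho_comm_apply ρ (gz_mul_gy_pow h b), map_mul, Module.End.mul_apply,
      rho_inv_eigen ρ (μ := (turn r t ω : ℂˣ) ^ b)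
        (by rw [Units.val_pow_eq_pow_val]; exact rho_pow_eigen ρ hx₁ b),
      map_smul, hz₁, map_smul]
    rfl
  have hp : ∀ b : ℕ, b ≤ p → ρ (gy h ^ b)⁻¹ v₁ = ρ (gy h ^ (p - b)) v₁ := by
    intro b hb
    rw [← one_mul (gy h ^ b)⁻¹, ← gy_pow h, ← pow_sub _ hb]
  have hshift : ∑ b ∈ Finset.range p, ρ (gy h ^ (b + 1)) v₁ =
      ∑ b ∈ Finset.range p, ρ (gy h ^ b) v₁ := by
    have h1 := Finset.sum_range_succ (fun b => ρ (gy h ^ b) v₁) p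
    have h2 := Finset.sum_range_succ' (fun b => ρ (gy h ^ b) v₁) p
    rw [gy_pow, h2, pow_zero] at h1
    exact add_right_cancel h1
  refine ⟨∑ b ∈ Finset.range p, ρ (gy h ^ b) v₁, ?_, ?_, ?_, ?_⟩
  -- The sum is nonzero: its p terms are eigenvectors of z with distinct eigenvalues, hence
  -- independent.
  · intro hcon
    have hli := linearIndependent_of_joint_eigenvectors (fun _ : Unit => ρ (gz h))
      (fun (b : Fin p) _ => (((turn r t ω : ℂˣ) ^ (b : ℕ))⁻¹ : ℂˣ))
      (fun i j hij => Fin.ext (hprim.pow_inj i.2 j.2 (by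
        have := inv_injective (Units.ext (congrFun hij ()))
        rw [← Units.val_pow_eq_pow_val, ← Units.val_pow_eq_pow_val, this])))
      (fun b : Fin p => ρ (gy h ^ (b : ℕ)) v₁) (fun b => rho_ne_zero ρ _ hne)
      (fun b _ => hz b)
    have := Fintype.linearIndependent_iff.1 hli (fun _ => 1) (by
      simp only [one_smul]
      rw [← hcon, Finset.sum_range]) ⟨0, h.prime.pos⟩
    exact one_ne_zero this
  · rw [map_sum, Finset.smul_sum]
    refine Finset.sum_congr rfl fun b _ => ?_
    rw [rho_comm_apply ρ (gx_mul_gy_pow h b), hx₁, map_smul]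
  · rw [map_sum]
    refine Eq.trans (Finset.sum_congr rfl fun b _ => ?_) hshift
    rw [pow_succ', map_mul, Module.End.mul_apply]
  -- As s inverts y it sends the term at b to `e` times the term at p - b; the shifted sum makes
  -- this an exact reflection of the range.
  · rw [map_sum, ← hshift, ← Finset.sum_range_reflect (fun b => ρ (gy h ^ (b + 1)) v₁),
      Finset.smul_sum]
    refine Finset.sum_congr rfl fun b hb => ?_
    have hb' := Finset.mem_range.1 hb
    rw [show p - 1 - b + 1 = p - b by omega, rho_comm_apply ρ (gs_mul_gy_pow h b), hs₁, map_smul,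
      hp b hb'.le]

theorem IsQVector.exists_turn_iterate {ω : rootsOfUnity p ℂ} {e : rootsOfUnity 2 ℂ} (hω : ω ≠ 1)
    {v : V} (hv : IsQVector ρ ω e v) (i : ℕ) : ∃ v', IsQVector ρ ((turn r t)^[i] ω) e v' := by
  induction i with
  | zero => exact ⟨v, hv⟩
  | succ i ih =>
    obtain ⟨w, hw⟩ := ih
    rw [Function.iterate_succ_apply']
    exact hw.exists_turn (turn_iterate_ne_one h hω i)

/-- Take an eigenvector of y inside the ω-eigenspace of x, correct its eigenvalue to 1 by a power of
z, then diagonalise s on the joint eigenspace, which it preserves because it inverts y. -/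
theorem exists_isQVector [FiniteDimensional ℂ V] {ω : rootsOfUnity p ℂ} (hω : ω ≠ 1) {v : V}
    (hv : v ≠ 0) (hx : ρ (gx h) v = ((ω : ℂˣ) : ℂ) • v) : ∃ e v', IsQVector ρ ω e v' := by
  have := h.fact_prime
  obtain ⟨v₁, hx₁, hv₁, η, hy₁⟩ := exists_eigenvector_mem (ρ (gy h))
    (Module.End.eigenspace (ρ (gx h)) ((ω : ℂˣ) : ℂ))
    ((Submodule.ne_bot_iff _).2 ⟨v, Module.End.mem_eigenspace_iff.2 hx, hv⟩) (fun w hw => by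
      rw [Module.End.mem_eigenspace_iff] at hw ⊢
      rw [rho_comm_apply ρ (gx_mul_gy h), hw, map_smul])
  rw [Module.End.mem_eigenspace_iff] at hx₁
  have hη : η ^ p = 1 := by
    have h1 := rho_pow_eigen ρ hy₁ p
    rw [gy_pow, map_one, Module.End.one_apply] at h1
    refine smul_left_injective ℂ hv₁ ?_
    simpa using h1.symm
  -- Applying z^c multiplies the y-eigenvalue by ω^c, and ω is a primitive p-th root of unity, so
  -- some `c` cancels η.
  obtain ⟨c, -, hc⟩ := (isPrimitiveRoot_of_ne_one hω).eq_pow_of_pow_eq_one (ξ := η⁻¹)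
    (by rw [inv_pow, hη, inv_one])
  have hη0 : η ≠ 0 := by
    rintro rfl
    rw [zero_pow h.prime.ne_zero] at hη
    exact zero_ne_one hη
  have hx₂ : ρ (gx h) (ρ (gz h ^ c) v₁) = ((ω : ℂˣ) : ℂ) • ρ (gz h ^ c) v₁ := by
    rw [rho_comm_apply ρ (gx_mul_gz_pow h c), hx₁, map_smul]
  have hy₂ : ρ (gy h) (ρ (gz h ^ c) v₁) = ρ (gz h ^ c) v₁ := by
    rw [rho_comm_apply ρ (gy_mul_gz_pow h c), map_mul, Module.End.mul_apply,
      rho_pow_eigen ρ hx₁, map_smul, hy₁, smul_smul, hc, inv_mul_cancel₀ hη0, one_smul]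
  obtain ⟨v₃, ⟨hx₃, hy₃⟩, hv₃, e, hs₃⟩ := exists_eigenvector_mem (ρ (gs h))
    (Module.End.eigenspace (ρ (gx h)) ((ω : ℂˣ) : ℂ) ⊓ Module.End.eigenspace (ρ (gy h)) 1)
    ((Submodule.ne_bot_iff _).2 ⟨ρ (gz h ^ c) v₁, ⟨Module.End.mem_eigenspace_iff.2 hx₂,
      Module.End.mem_eigenspace_iff.2 (by rw [hy₂, one_smul])⟩, rho_ne_zero ρ _ hv₁⟩)
    (by
      rintro w ⟨hwx, hwy⟩
      rw [SetLike.mem_coe, Module.End.mem_eigenspace_iff] at hwx hwy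
      rw [one_smul] at hwy
      refine ⟨?_, ?_⟩
      · rw [SetLike.mem_coe, Module.End.mem_eigenspace_iff, rho_comm_apply ρ (gx_mul_gs h), hwx,
          map_smul]
      · rw [SetLike.mem_coe, Module.End.mem_eigenspace_iff, rho_comm_apply ρ (gy_mul_gs h),
          ρ.inv_apply_eq_iff.2 hwy.symm, one_smul])
  rw [SetLike.mem_coe, Module.End.mem_eigenspace_iff] at hx₃ hy₃
  rw [one_smul] at hy₃
  have he : e ^ 2 = 1 := by
    have h1 := rho_pow_eigen ρ hs₃ 2
    rw [pow_two, gs_mul_gs, map_one, Module.End.one_apply] at h1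
    refine smul_left_injective ℂ hv₃ ?_
    simpa using h1.symm
  exact ⟨rootsOfUnity.mkOfPowEq e he, v₃, hv₃, hx₃, hy₃, hs₃⟩

/-- Powers of w change the x-eigenvalue, and powers of z then multiply the y-eigenvalue by powers of
it. The y-eigenvalue 1 occurs only for z^0, so the sign `e` of s can be recovered from the
representation. -/
theorem IsQVector.exists_basis {ω : rootsOfUnity p ℂ} {e : rootsOfUnity 2 ℂ} (hω : ω ≠ 1)
    {v : V} (hv : IsQVector ρ ω e v) :
    ∃ (χ : Fin (2 ^ (n - 1)) × ZMod p → Bool → ℂ) (b : Fin (2 ^ (n - 1)) × ZMod p → V),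
      Function.Injective χ ∧ (∀ i, b i ≠ 0) ∧
      (∀ i j, (if j then ρ (gx h) else ρ (gy h)) (b i) = χ i j • b i) ∧
      (∀ i, χ i true = (((turn r t)^[(i.1 : ℕ)] ω : ℂˣ) : ℂ) ∧
        (χ i false = 1 → ρ (gs h) (b i) = ((e : ℂˣ) : ℂ) • b i)) := by
  have := h.fact_prime
  choose w hw using fun i : Fin (2 ^ (n - 1)) => hv.exists_turn_iterate hω i
  have hprim := fun i : ℕ => isPrimitiveRoot_of_ne_one (turn_iterate_ne_one h hω i)
  refine ⟨fun i j => if j then (((turn r t)^[(i.1 : ℕ)] ω : ℂˣ) : ℂ) else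
    (((turn r t)^[(i.1 : ℕ)] ω : ℂˣ) : ℂ) ^ i.2.val, fun i => ρ (gz h ^ i.2.val) (w i.1),
    ?_, fun i => rho_ne_zero ρ _ (hw i.1).1, ?_, fun i => ⟨if_pos rfl, fun hi => ?_⟩⟩
  · rintro ⟨i, c⟩ ⟨j, d⟩ hij
    have h1 := congrFun hij true
    have h2 := congrFun hij false
    simp only [if_true, Bool.false_eq_true, if_false] at h1 h2
    obtain rfl : i = j := turn_iterate_injective h hω (Subtype.ext (Units.ext h1))
    refine Prod.ext rfl (ZMod.val_injective p ?_)
    exact (hprim i).pow_inj (ZMod.val_lt c) (ZMod.val_lt d) h2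
  · rintro ⟨i, c⟩ j
    cases j
    · simp only [Bool.false_eq_true, if_false]
      rw [rho_comm_apply ρ (gy_mul_gz_pow h _), map_mul, Module.End.mul_apply,
        rho_pow_eigen ρ (hw i).2.1, map_smul, (hw i).2.2.1, map_smul]
    · simp only [if_true]
      rw [rho_comm_apply ρ (gx_mul_gz_pow h _), (hw i).2.1, map_smul]
  · simp only [Bool.false_eq_true, if_false] at hi
    have h0 : i.2.val = 0 :=
      (hprim i.1).pow_inj (ZMod.val_lt i.2) h.prime.pos (hi.trans (pow_zero _).symm)
    simp only [h0, pow_zero, map_one, Module.End.one_apply]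
    exact (hw i.1).2.2.2

end

theorem Q_eq_closure (h : Admissible p n t r k q) :
    Q h = Subgroup.closure {gx h, gy h, gs h} := rfl

theorem generators_mem_Q (h : Admissible p n t r k q) :
    ∀ g ∈ ({gx h, gy h, gs h} : Set (G h)), g ∈ Q h := by
  rintro _ (rfl | rfl | rfl)
  exacts [gx_mem_Q h, gy_mem_Q h, gs_mem_Q h]

theorem charQ_gy (ψ : Q h →* ℂˣ) : ψ ⟨gy h, gy_mem_Q h⟩ = 1 := by
  have h1 : (⟨gy h, gy_mem_Q h⟩ * ⟨gs h, gs_mem_Q h⟩ : Q h) =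
      ⟨gs h, gs_mem_Q h⟩ * ⟨gy h, gy_mem_Q h⟩⁻¹ := Subtype.ext (gy_mul_gs h)
  have h2 := congrArg ψ h1
  rw [map_mul, map_mul, map_inv, mul_comm (ψ ⟨gs h, _⟩), mul_left_inj, eq_inv_iff_mul_eq_one,
    ← pow_two] at h2
  refine eq_one_of_sq_of_odd_pow h.odd_prime h2 ?_
  rw [← map_pow]
  exact (congrArg ψ (Subtype.ext (gy_pow h))).trans (map_one ψ)

section

variable {V : Type*} [AddCommGroup V] [Module ℂ V] {ρ : Representation ℂ (G h) V}

theorem isQVector_iff {ω : rootsOfUnity p ℂ} {e : rootsOfUnity 2 ℂ} {ψ : Q h →* ℂˣ}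
    (hx : ψ ⟨gx h, gx_mem_Q h⟩ = ω) (hs : ψ ⟨gs h, gs_mem_Q h⟩ = e) (v : V) :
    IsQVector ρ ω e v ↔ IsEigen ρ (Q h) ψ v := by
  constructor
  · rintro ⟨hv, hvx, hvy, hvs⟩
    refine isEigen_of_generators ρ _ _ (Q_eq_closure h) (generators_mem_Q h) _ v hv ?_
    rintro _ (rfl | rfl | rfl)
    · rw [hvx, hx]
    · rw [hvy, charQ_gy, Units.val_one, one_smul]
    · rw [hvs, hs]
  · rintro ⟨hv, hg⟩
    refine ⟨hv, ?_, ?_, ?_⟩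
    · rw [← hx]
      exact hg ⟨gx h, gx_mem_Q h⟩
    · have := hg ⟨gy h, gy_mem_Q h⟩
      rwa [charQ_gy, Units.val_one, one_smul] at this
    · rw [← hs]
      exact hg ⟨gs h, gs_mem_Q h⟩

theorem IsQVector.character_eq [FiniteDimensional ℂ V] (hρ : ρ.IsIrreducible)
    {ω : rootsOfUnity p ℂ} {e : rootsOfUnity 2 ℂ} (hω : ω ≠ 1) {ψ : Q h →* ℂˣ}
    (hx : ψ ⟨gx h, gx_mem_Q h⟩ = ω) (hs : ψ ⟨gs h, gs_mem_Q h⟩ = e) {v : V}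
    (hv : IsQVector ρ ω e v) :
    finrank ℂ V = 2 ^ (n - 1) * p ∧ ρ.character = indChar (Q h) ψ := by
  have := h.fact_prime
  obtain ⟨χ, b, hχ, hb, hT, -⟩ := hv.exists_basis hω
  have hli := linearIndependent_of_joint_eigenvectors _ χ hχ b hb hT
  have := character_eq_indChar ρ hρ (Q h) ψ v ((isQVector_iff hx hs v).1 hv)
    (fun i : Fin (2 ^ (n - 1)) × ZMod p => gw h ^ (i.1 : ℕ) * gz h ^ i.2.val) (exists_coset_Q h)
    hli.fintype_card_le_finrank
  rwa [Fintype.card_prod, Fintype.card_fin, ZMod.card] at this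

end

/-- Start from a representation of `G` in which x has eigenvalue ω: it yields a character of `Q`
with some sign at s, which a linear character of `G` corrects without changing the value at x. -/
theorem exists_charQ (h : Admissible p n t r k q) {ω : rootsOfUnity p ℂ} (hω : ω ≠ 1)
    (e : rootsOfUnity 2 ℂ) :
    ∃ ψ : Q h →* ℂˣ, ψ ⟨gx h, gx_mem_Q h⟩ = ω ∧ ψ ⟨gs h, gs_mem_Q h⟩ = e := by
  have := h.fact_prime
  obtain ⟨ψ, e', hx, hs⟩ : ∃ (ψ : Q h →* ℂˣ) (e' : rootsOfUnity 2 ℂ),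
      ψ ⟨gx h, gx_mem_Q h⟩ = ω ∧ ψ ⟨gs h, gs_mem_Q h⟩ = e' := by
    have hmem : gx h ∈ Subgroup.zpowers (gx h) := Subgroup.mem_zpowers _
    have hgen : ∀ g : Subgroup.zpowers (gx h), g ∈ Subgroup.zpowers
        (⟨gx h, hmem⟩ : Subgroup.zpowers (gx h)) := by
      rintro ⟨_, m, rfl⟩
      exact ⟨m, rfl⟩
    -- Here the nontriviality of x enters: x has order exactly p.
    have hord : orderOf (ω : ℂˣ) ∣ orderOf (⟨gx h, hmem⟩ : Subgroup.zpowers (gx h)) := by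
      rw [Subgroup.orderOf_mk, orderOf_eq_prime (gx_pow h) (gx_ne_one h)]
      exact orderOf_dvd_of_pow_eq_one ((mem_rootsOfUnity _ _).1 ω.2)
    obtain ⟨V, _, _, _, ρ, v, -, hv⟩ := exists_irreducible_isEigen _
      (monoidHomOfForallMemZpowers hgen hord)
    have hx := hv.2 ⟨gx h, hmem⟩
    rw [monoidHomOfForallMemZpowers_apply_gen] at hx
    obtain ⟨e', v', hv', hx', hy', hs'⟩ := exists_isQVector hω hv.1 hx
    obtain ⟨ψ, hψ⟩ := exists_hom_of_eigenvector ρ {gx h, gy h, gs h} v' hv' (by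
      rintro _ (rfl | rfl | rfl)
      exacts [⟨_, hx'⟩, ⟨1, by rw [hy', one_smul]⟩, ⟨_, hs'⟩])
    refine ⟨ψ, e', ?_, ?_⟩
    · exact Units.ext (smul_left_injective ℂ hv' ((hψ.2 ⟨gx h, gx_mem_Q h⟩).symm.trans hx'))
    · exact Units.ext (smul_left_injective ℂ hv' ((hψ.2 ⟨gs h, gs_mem_Q h⟩).symm.trans hs'))
  -- As s = w^(2^(n-1)), the value at w must be a 2^(n-1)-th root of the required change of sign.
  obtain ⟨ζ, hζ⟩ := IsAlgClosed.exists_pow_nat_eq (((e * e'⁻¹ : rootsOfUnity 2 ℂ) : ℂˣ) : ℂ)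
    (Nat.two_pow_pos (n - 1))
  have hζ0 : ζ ≠ 0 := by
    rintro rfl
    rw [zero_pow (by positivity)] at hζ
    exact Units.ne_zero _ hζ.symm
  have hζ' : (Units.mk0 ζ hζ0) ^ 2 ^ (n - 1) = ((e * e'⁻¹ : rootsOfUnity 2 ℂ) : ℂˣ) :=
    Units.ext hζ
  obtain ⟨l, hl⟩ := exists_linear h (ζ := Units.mk0 ζ hζ0) (by
    rw [h.two_pow_eq', pow_mul, hζ']
    exact (mem_rootsOfUnity _ _).1 (Subtype.prop _))
  refine ⟨ψ * l.comp (Q h).subtype, ?_, ?_⟩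
  · rw [MonoidHom.mul_apply, hx]
    exact mul_eq_left.2 (linear_gx h l)
  · have h1 : l (gs h) = ((e * e'⁻¹ : rootsOfUnity 2 ℂ) : ℂˣ) := by
      rw [gs, map_pow, hl, hζ']
    rw [MonoidHom.mul_apply, hs]
    refine (congrArg _ h1).trans ?_
    simp

/-- The pairs of values that a linear character of `Q` without `x` in its kernel can take at `x`
and `w ^ (2 ^ (n - 1))`. -/
abbrev QData (p : ℕ) : Type := {ω : rootsOfUnity p ℂ // ω ≠ 1} × rootsOfUnity 2 ℂ

/-- The linear character of `Q` with given values at `x` and `w ^ (2 ^ (n - 1))`. -/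
noncomputable def charQ (h : Admissible p n t r k q) (a : QData p) : Q h →* ℂˣ :=
  (exists_charQ h a.1.2 a.2).choose

theorem charQ_gx (a : QData p) : charQ h a ⟨gx h, gx_mem_Q h⟩ = a.1.1 :=
  (exists_charQ h a.1.2 a.2).choose_spec.1

theorem charQ_gs (a : QData p) : charQ h a ⟨gs h, gs_mem_Q h⟩ = a.2 :=
  (exists_charQ h a.1.2 a.2).choose_spec.2

theorem exists_charQ_eq (ψ : Q h →* ℂˣ) (hψ : ψ ⟨gx h, gx_mem_Q h⟩ ≠ 1) :
    ∃ a, charQ h a = ψ := by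
  have hx : ψ ⟨gx h, gx_mem_Q h⟩ ∈ rootsOfUnity p ℂ := by
    rw [mem_rootsOfUnity, ← map_pow]
    exact (congrArg ψ (Subtype.ext (gx_pow h))).trans (map_one ψ)
  have hs : ψ ⟨gs h, gs_mem_Q h⟩ ∈ rootsOfUnity 2 ℂ := by
    rw [mem_rootsOfUnity, ← map_pow, pow_two]
    exact (congrArg ψ (Subtype.ext (gs_mul_gs h))).trans (map_one ψ)
  refine ⟨(⟨⟨_, hx⟩, fun hcon => hψ (congrArg Subtype.val hcon)⟩, ⟨_, hs⟩), ?_⟩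
  refine hom_ext_of_generators _ _ (Q_eq_closure h) (generators_mem_Q h) ?_
  rintro _ (rfl | rfl | rfl)
  · exact charQ_gx _
  · rw [charQ_gy, charQ_gy]
  · exact charQ_gs _

section

variable {V : Type*} [AddCommGroup V] [Module ℂ V] {ρ : Representation ℂ (G h) V}

theorem IsQVector.exists_iterate_eq [FiniteDimensional ℂ V] (hρ : ρ.IsIrreducible)
    {a b : QData p} {v v' : V} (hv : IsQVector ρ a.1 a.2 v) (hv' : IsQVector ρ b.1 b.2 v') :
    (∃ i : Fin (2 ^ (n - 1)), (turn r t)^[(i : ℕ)] a.1.1 = b.1) ∧ a.2 = b.2 := by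
  have := h.fact_prime
  obtain ⟨χ, w, hχ, hw, hT, hχ'⟩ := hv.exists_basis a.1.2
  obtain ⟨i, hi, c, rfl⟩ := eq_smul_of_joint_eigenvector _ χ hχ w hw hT
    (by rw [Fintype.card_prod, Fintype.card_fin, ZMod.card,
      (hv.character_eq hρ a.1.2 (charQ_gx a) (charQ_gs a)).1])
    (fun j => if j then (((b.1 : rootsOfUnity p ℂ) : ℂˣ) : ℂ) else 1) v' hv'.1 (by
      rintro (_ | _)
      · simpa using hv'.2.2.1
      · exact hv'.2.1)
  refine ⟨⟨i.1, Subtype.ext (Units.ext ?_)⟩, Subtype.ext (Units.ext ?_)⟩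
  · rw [← (hχ' i).1, hi]
    rfl
  · have h1 := hv'.2.2.2
    -- The vector is fixed by y, so it lies on a basis line with y-eigenvalue 1, where s acts by
    -- `a.2`.
    rw [map_smul, (hχ' i).2 (by rw [hi]; rfl), smul_comm] at h1
    exact smul_left_injective ℂ hv'.1 h1

end

theorem exists_irreducible_isQVector (h : Admissible p n t r k q) (a : QData p) :
    ∃ (W : Type) (_ : AddCommGroup W) (_ : Module ℂ W) (_ : FiniteDimensional ℂ W)
      (σ : Representation ℂ (G h) W) (w : W), σ.IsIrreducible ∧ IsQVector σ a.1 a.2 w := by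
  obtain ⟨W, _, _, _, σ, w, hσ, hw⟩ := exists_irreducible_isEigen (Q h) (charQ h a)
  exact ⟨W, _, _, inferInstance, σ, w, hσ, (isQVector_iff (charQ_gx a) (charQ_gs a) w).2 hw⟩

theorem indChar_charQ_eq_iff {a b : QData p} :
    indChar (Q h) (charQ h b) = indChar (Q h) (charQ h a) ↔
      (∃ i : Fin (2 ^ (n - 1)), (turn r t)^[(i : ℕ)] a.1.1 = b.1) ∧ a.2 = b.2 := by
  obtain ⟨V, _, _, _, ρ, v, hρ, hv⟩ := exists_irreducible_isQVector h a
  have hchar := (hv.character_eq hρ a.1.2 (charQ_gx a) (charQ_gs a)).2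
  constructor
  · intro hab
    obtain ⟨W, _, _, _, σ, w, hσ, hw⟩ := exists_irreducible_isQVector h b
    have hchar' := (hw.character_eq hσ b.1.2 (charQ_gx b) (charQ_gs b)).2
    obtain ⟨e⟩ := nonempty_equiv_of_character_eq ρ σ hρ hσ (by rw [hchar, hchar', hab])
    exact hv.exists_iterate_eq hρ ((isQVector_iff (charQ_gx b) (charQ_gs b) _).2
      (isEigen_of_equiv e ((isQVector_iff (charQ_gx b) (charQ_gs b) w).1 hw)))
  · rintro ⟨⟨i, hi⟩, he⟩
    obtain ⟨v', hv'⟩ := hv.exists_turn_iterate a.1.2 i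
    rw [hi, he] at hv'
    rw [← hchar, (hv'.character_eq hρ b.1.2 (charQ_gx b) (charQ_gs b)).2]

theorem familyQ_eq_range (h : Admissible p n t r k q) :
    familyQ h = Set.range fun a : QData p => indChar (Q h) (charQ h a) := by
  ext χ
  constructor
  · rintro ⟨ψ, hψ, rfl⟩
    obtain ⟨a, rfl⟩ := exists_charQ_eq ψ hψ
    exact ⟨a, rfl⟩
  · rintro ⟨a, rfl⟩
    refine ⟨charQ h a, fun hcon => a.1.2 (Subtype.ext ?_), rfl⟩
    rw [← charQ_gx (h := h) a, hcon]
    rfl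

theorem familyQ_subset_irrChar (h : Admissible p n t r k q) : familyQ h ⊆ IrrChar (G h) := by
  rw [familyQ_eq_range]
  rintro _ ⟨a, rfl⟩
  obtain ⟨V, _, _, _, ρ, v, hρ, hv⟩ := exists_irreducible_isQVector h a
  exact ⟨V, _, _, inferInstance, ρ, hρ, (hv.character_eq hρ a.1.2 (charQ_gx a) (charQ_gs a)).2⟩

theorem familyQ_degree (h : Admissible p n t r k q) :
    ∀ χ ∈ familyQ h, χ 1 = p * 2 ^ (n - 1) := by
  rw [familyQ_eq_range]
  rintro _ ⟨a, rfl⟩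
  obtain ⟨V, _, _, _, ρ, v, hρ, hv⟩ := exists_irreducible_isQVector h a
  have hd := hv.character_eq hρ a.1.2 (charQ_gx a) (charQ_gs a)
  dsimp only
  rw [← hd.2, Representation.char_one, hd.1, mul_comm]
  push_cast
  rfl

theorem familyQ_finite (h : Admissible p n t r k q) : (familyQ h).Finite := by
  have := h.fact_prime
  rw [familyQ_eq_range]
  exact Set.finite_range _

/-- There are p - 1 values at x and two at s; since w commutes with s, an orbit varies only the
former. -/
theorem familyQ_card (h : Admissible p n t r k q) :
    (p - 1) * 2 = 2 ^ (n - 1) * (familyQ h).ncard := by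
  have := h.fact_prime
  have hcard : Nat.card (QData p) = (p - 1) * 2 := by
    rw [Nat.card_prod, Nat.card_subtype_ne, Complex.card_rootsOfUnity, Complex.card_rootsOfUnity]
  rw [← hcard, familyQ_eq_range]
  refine card_eq_mul_ncard_range _ _ fun a => ?_
  refine ⟨fun i => (⟨_, turn_iterate_ne_one h a.1.2 i⟩, a.2), fun i j hij => ?_, fun b => ?_⟩
  · exact turn_iterate_injective h a.1.2 (congrArg (fun c : QData p => c.1.1) hij)
  · rw [indChar_charQ_eq_iff]
    simp only [Prod.ext_iff, Subtype.ext_iff, exists_and_right]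

end GpTwo

/-! ### Completeness and disjointness of the two families. -/

namespace GpTwo

variable {p n t : ℕ} {r k q : ℤ} {h : Admissible p n t r k q}

section

variable {V : Type*} [AddCommGroup V] [Module ℂ V] {ρ : Representation ℂ (G h) V}

/-- The subgroup generated by x is normal, so its fixed space is invariant, and irreducibility makes
it everything. -/
theorem forall_gx_fixed (hρ : ρ.IsIrreducible) {v : V} (hv : v ≠ 0) (hx : ρ (gx h) v = v) (w : V) :
    ρ (gx h) w = w := by
  have htop : Module.End.eigenspace (ρ (gx h)) 1 = ⊤ := by
    refine hρ.eq_top_of_invariant ρ _ (invariant_of_generators ρ (submonoid_closure_generators h) _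
      ?_) ((Submodule.ne_bot_iff _).2
        ⟨v, Module.End.mem_eigenspace_iff.2 (by rw [hx, one_smul]), hv⟩)
    intro g hg w hw
    rw [Module.End.mem_eigenspace_iff, one_smul] at hw ⊢
    rcases hg with rfl | rfl | rfl | rfl
    · rw [hw, hw]
    · rw [rho_comm_apply ρ (gx_mul_gy h), hw]
    · rw [rho_comm_apply ρ (gx_mul_gz h), hw]
    · rw [rho_comm_apply ρ (gx_mul_gw h), rho_zpow_fixed ρ hw]
  have hw : w ∈ Module.End.eigenspace (ρ (gx h)) 1 := htop ▸ Submodule.mem_top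
  rwa [Module.End.mem_eigenspace_iff, one_smul] at hw

theorem exists_isPVector_of_gx_fixed [FiniteDimensional ℂ V] [Nontrivial V]
    (hx : ∀ w, ρ (gx h) w = w) : ∃ (a : PData p) (v : V), IsPVector ρ a v := by
  have root : ∀ g : G h, g ^ p = 1 → ∀ (μ : ℂ) (v : V), v ≠ 0 → ρ g v = μ • v → μ ^ p = 1 := by
    intro g hg μ v hv hμ
    have h1 := rho_pow_eigen ρ hμ p
    rw [hg, map_one, Module.End.one_apply] at h1
    refine smul_left_injective ℂ hv ?_
    simpa using h1.symm
  have := h.fact_prime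
  obtain ⟨v, -, hv, α, hα⟩ := exists_eigenvector_mem (ρ (gy h)) ⊤ top_ne_bot (by simp)
  obtain ⟨w, hw, hw0, β, hβ⟩ := exists_eigenvector_mem (ρ (gz h))
    (Module.End.eigenspace (ρ (gy h)) α)
    ((Submodule.ne_bot_iff _).2 ⟨v, Module.End.mem_eigenspace_iff.2 hα, hv⟩) (fun w hw => by
      rw [Module.End.mem_eigenspace_iff] at hw ⊢
      rw [rho_comm_apply ρ ((gy_mul_gz h).trans (mul_assoc _ _ _)), map_mul,
        Module.End.mul_apply, hx, hw, map_smul])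
  rw [Module.End.mem_eigenspace_iff] at hw
  exact ⟨(rootsOfUnity.mkOfPowEq α (root _ (gy_pow h) _ _ hv hα),
    rootsOfUnity.mkOfPowEq β (root _ (gz_pow h) _ _ hw0 hβ)), w, hw0, hx w, hw, hβ⟩

/-- The fixed space of `P` is invariant, hence all of `V`; then any eigenvector of `w` spans an
invariant line. -/
theorem finrank_eq_one_of_P_fixed [FiniteDimensional ℂ V] (hρ : ρ.IsIrreducible) {v : V}
    (hv : IsPVector ρ (1 : PData p) v) : finrank ℂ V = 1 := by
  set W := Module.End.eigenspace (ρ (gx h)) 1 ⊓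
    (Module.End.eigenspace (ρ (gy h)) 1 ⊓ Module.End.eigenspace (ρ (gz h)) 1) with hW
  have mem : ∀ w, w ∈ W ↔ ρ (gx h) w = w ∧ ρ (gy h) w = w ∧ ρ (gz h) w = w := by
    intro w
    simp only [hW, Submodule.mem_inf, Module.End.mem_eigenspace_iff, one_smul]
  have hvW : v ∈ W := by
    obtain ⟨-, hx, hy, hz⟩ := hv
    rw [mem]
    exact ⟨hx, by simpa using hy, by simpa using hz⟩
  have htop : W = ⊤ := by
    refine hρ.eq_top_of_invariant ρ _ (invariant_of_generators ρ (submonoid_closure_generators h) _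
      ?_) ((Submodule.ne_bot_iff _).2 ⟨v, hvW, hv.1⟩)
    intro g hg w hw
    obtain ⟨hx, hy, hz⟩ := (mem w).1 hw
    rcases hg with rfl | rfl | rfl | rfl
    · rwa [hx]
    · rwa [hy]
    · rwa [hz]
    · rw [mem, rho_comm_apply ρ (gx_mul_gw h), rho_comm_apply ρ (gy_mul_gw h),
        rho_comm_apply ρ (gz_mul_gw h), rho_zpow_fixed ρ hx, rho_zpow_fixed ρ hy,
        rho_zpow_fixed ρ hz]
      exact ⟨rfl, rfl, rfl⟩
  have hfix : ∀ w, ρ (gx h) w = w ∧ ρ (gy h) w = w ∧ ρ (gz h) w = w :=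
    fun w => (mem w).1 (htop ▸ Submodule.mem_top)
  have : Nontrivial V := hρ.nontrivial_space
  obtain ⟨u, -, hu, μ, hμ⟩ := exists_eigenvector_mem (ρ (gw h)) ⊤ top_ne_bot (by simp)
  have hline : Submodule.span ℂ {u} = ⊤ := by
    refine hρ.eq_top_of_invariant ρ _ (invariant_of_generators ρ (submonoid_closure_generators h) _
      ?_) (by simpa using hu)
    intro g hg w hw
    rcases hg with rfl | rfl | rfl | rfl
    · rwa [(hfix w).1]
    · rwa [(hfix w).2.1]
    · rwa [(hfix w).2.2]
    · obtain ⟨c, rfl⟩ := Submodule.mem_span_singleton.1 hw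
      rw [map_smul, hμ]
      exact Submodule.smul_mem _ _ (Submodule.smul_mem _ _ (Submodule.mem_span_singleton_self u))
  rw [← finrank_top ℂ V, ← hline, finrank_span_singleton hu]

/-- The dichotomy is whether a chosen eigenvalue of x equals 1. -/
theorem character_mem_families [FiniteDimensional ℂ V] (hρ : ρ.IsIrreducible)
    (hdim : finrank ℂ V ≠ 1) : ρ.character ∈ familyP h ∪ familyQ h := by
  have : Nontrivial V := hρ.nontrivial_space
  obtain ⟨v, -, hv, μ, hμ⟩ := exists_eigenvector_mem (ρ (gx h)) ⊤ top_ne_bot (by simp)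
  by_cases hμ1 : μ = 1
  · rw [hμ1, one_smul] at hμ
    obtain ⟨a, w, hw⟩ := exists_isPVector_of_gx_fixed (forall_gx_fixed hρ hv hμ)
    have ha : a ≠ 1 := by
      rintro rfl
      exact hdim (finrank_eq_one_of_P_fixed hρ hw)
    left
    rw [familyP_eq_range]
    exact ⟨⟨a, ha⟩, (hw.character_eq hρ ha).2.symm⟩
  · have := h.fact_prime
    have hμp : μ ^ p = 1 := by
      have h1 := rho_pow_eigen ρ hμ p
      rw [gx_pow, map_one, Module.End.one_apply] at h1
      refine smul_left_injective ℂ hv ?_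
      simpa using h1.symm
    have hω : rootsOfUnity.mkOfPowEq μ hμp ≠ 1 := by
      intro hcon
      exact hμ1 (congrArg (fun ω : rootsOfUnity p ℂ => ((ω : ℂˣ) : ℂ)) hcon)
    obtain ⟨e, w, hw⟩ := exists_isQVector hω hv hμ
    right
    rw [familyQ_eq_range]
    exact ⟨(⟨_, hω⟩, e), (hw.character_eq hρ hω (charQ_gx (⟨_, hω⟩, e))
      (charQ_gs (⟨_, hω⟩, e))).2.symm⟩

end

theorem degree_Q_ne (h : Admissible p n t r k q) :
    p * 2 ^ (n - 1) ≠ 2 ^ n ∧ p * 2 ^ (n - 1) ≠ 1 ∧ 2 ^ n ≠ 1 := by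
  have h2 := h.two_lt
  have h3 := h.two_pow_eq'
  have h4 : 0 < 2 ^ (n - 1) := Nat.two_pow_pos _
  refine ⟨?_, ?_, ?_⟩
  · rw [h3, mul_comm]
    intro hcon
    exact h2.ne' (Nat.eq_of_mul_eq_mul_left h4 hcon)
  · nlinarith
  · omega

theorem nonlinear_irrChar_eq (h : Admissible p n t r k q) :
    { χ ∈ IrrChar (G h) | χ 1 ≠ 1 } = familyP h ∪ familyQ h := by
  obtain ⟨-, h1, h2⟩ := degree_Q_ne h
  ext χ
  constructor
  · rintro ⟨⟨V, _, _, _, ρ, hρ, rfl⟩, hdim⟩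
    refine character_mem_families hρ fun hcon => hdim ?_
    rw [Representation.char_one, hcon, Nat.cast_one]
  · rintro (hχ | hχ)
    · refine ⟨familyP_subset_irrChar h hχ, ?_⟩
      rw [familyP_degree h χ hχ]
      exact_mod_cast h2
    · refine ⟨familyQ_subset_irrChar h hχ, ?_⟩
      rw [familyQ_degree h χ hχ]
      exact_mod_cast h1

/-- The degrees p·2^(n-1) and 2^n differ because p > 2. -/
theorem disjoint_families (h : Admissible p n t r k q) : Disjoint (familyP h) (familyQ h) := by
  rw [Set.disjoint_left]
  intro χ hP hQ
  have := (familyQ_degree h χ hQ).symm.trans (familyP_degree h χ hP)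
  exact (degree_Q_ne h).1 (by exact_mod_cast this)

end GpTwo

theorem theorem6 (p n t : ℕ) (r k q : ℤ) (h : GpTwo.Admissible p n t r k q) :
    -- the linear characters
    (Nat.card (GpTwo.G h →* ℂˣ) = 2 ^ n ∧
      (∀ l : GpTwo.G h →* ℂˣ, ∀ g ∈ GpTwo.P h, l g = 1) ∧
      (∀ ζ : ℂˣ, IsPrimitiveRoot ζ (2 ^ n) →
        ∃ l : Fin (2 ^ n) → (GpTwo.G h →* ℂˣ), Function.Bijective l ∧
          ∀ i : Fin (2 ^ n), l i (GpTwo.gx h) = 1 ∧ l i (GpTwo.gy h) = 1 ∧ l i (GpTwo.gz h) = 1 ∧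
            l i (GpTwo.gw h) = ζ ^ (i : ℕ)) ∧
      { χ ∈ IrrChar (GpTwo.G h) | χ 1 = 1 } =
        Set.range (fun (l : GpTwo.G h →* ℂˣ) (g : GpTwo.G h) => (l g : ℂ))) ∧
    -- the nonlinear irreducible characters
    ({ χ ∈ IrrChar (GpTwo.G h) | χ 1 ≠ 1 } = GpTwo.familyP h ∪ GpTwo.familyQ h ∧
      Disjoint (GpTwo.familyP h) (GpTwo.familyQ h)) ∧
    ((GpTwo.familyP h).Finite ∧ ((GpTwo.familyP h).ncard : ℚ) = ((p : ℚ) ^ 2 - 1) / 2 ^ n ∧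
      ∀ χ ∈ GpTwo.familyP h, χ 1 = 2 ^ n) ∧
    ((GpTwo.familyQ h).Finite ∧ ((GpTwo.familyQ h).ncard : ℚ) = ((p : ℚ) - 1) / 2 ^ (n - 2) ∧
      ∀ χ ∈ GpTwo.familyQ h, χ 1 = p * 2 ^ (n - 1)) := by
  have hp : 1 ≤ p := h.prime.one_le
  refine ⟨⟨GpTwo.card_linear h, GpTwo.linear_trivial_on_P h,
    fun ζ hζ => GpTwo.exists_linear_enumeration h hζ, degree_one_irrChar_eq⟩,
    ⟨GpTwo.nonlinear_irrChar_eq h, GpTwo.disjoint_families h⟩,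
    ⟨GpTwo.familyP_finite h, ?_, GpTwo.familyP_degree h⟩,
    ⟨GpTwo.familyQ_finite h, ?_, GpTwo.familyQ_degree h⟩⟩
  · have h1 := congrArg (Nat.cast : ℕ → ℚ) (GpTwo.familyP_card h)
    rw [Nat.cast_sub (Nat.one_le_pow _ _ hp)] at h1
    push_cast at h1
    rw [h1, mul_div_cancel_left₀ _ (by positivity)]
  · have h1 := congrArg (Nat.cast : ℕ → ℚ) (GpTwo.familyQ_card h)
    -- The factor 2 split off from 2^(n-1) cancels the two possible values at s.
    rw [h.two_pow_eq, Nat.cast_mul, Nat.cast_sub hp] at h1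
    push_cast at h1
    rw [eq_div_iff (by positivity)]
    linarith
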